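/- Let $q$ be a prime power and let $\mathscr H$ be the Hermitian curve over $\mathbb F_{q^2}$, with function field $\mathbb F_{q^2}(\mathscr H)=\mathbb F_{q^2}(x,y)$, $x^{q+1}=y^q+y$. Let $P_\infty=(0:1:0)$ be its point at infinity and let $D=\sum_S S$ be the sum of all affine $\mathbb F_{q^2}$-rational points $S=(a,b)$, $a^{q+1}=b^q+b$. Let $G$ be any divisor of $\mathbb F_{q^2}(\mathscr H)$ (a finite integral combination of places) whose support contains no point of $D$, and put $E=(q^3+q^2-q-2)P_\infty-G$. Here $\mathscr L(E)$ is the space of functions $f$ with $f=0$ or $\mathrm{div}(f)\succeq -E$; $\Omega(G-D)$ is the space of differentials $\omega$ with $\omega=0$ or $\mathrm{div}(\omega)\succeq G-D$; $C_L(D,E)=\{(f(S))_S: f\in\mathscr L(E)\}$; and $C_\Omega(D,G)=\{(\mathrm{res}_S\,\omega)_S:\omega\in\Omega(G-D)\}$. Two codes are monomially equivalent if one is carried onto the other by a permutation of the coordinates followed by multiplication of the coordinates by nonzero scalars. Then the codes $C_\Omega(D,G)$ and $C_L(D,(q^3+q^2-q-2)P_\infty-G)$ are monomially equivalent. Explicitly,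 let $$R=x\prod_{c\in\mathbb F_{q^2},\,c^q+c\ne0}(y-c),\qquad u(a,b)=\begin{cases}\displaystyle\prod_{c\in\mathbb F_{q^2},\,c^q+c\neq 0}(b-c), & a=0,\\[2ex] \displaystyle a^{q+1}\prod_{c\in\mathbb F_{q^2},\,c^q+c\ne0,\ c\neq b}(b-c), & a\ne0.\end{cases}$$ Then: 1. $f\mapsto g\,dx$ with $g=f/R$ is a bijection from $\mathscr L(E)$ onto $\Omega(G-D)$; 2. $u(S)\neq0$ for every affine $\mathbb F_{q^2}$-rational point $S$, and $\mathrm{res}_S(g\,dx)=u(S)^{-1}f(S)$ for every $f\in\mathscr L(E)$; 3. hence $C_\Omega(D,G)=\{(u(S)^{-1}c_S)_S : c\in C_L(D,E)\}$. -/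

import Mathlib

open Polynomial

noncomputable section

/-! ### Places, divisors, differentials and residues in a function field `K` over `k` -/

/-- A place of `K / k`, given by its valuation ring `k ⊆ O ⊊ K`. -/
structure Place (k K : Type*) [Field k] [Field K] [Algebra k K] where
  ring : ValuationSubring K
  algebraMap_mem : ∀ c : k, algebraMap k K c ∈ ring
  ne_top : ring ≠ ⊤

/-- Divisors are finitely supported integral combinations of places. -/
abbrev Divisor (k K : Type*) [Field k] [Field K] [Algebra k K] := Place k K →₀ ℤ

namespace Place

variable {k K : Type*} [Field k] [Field K] [Algebra k K]

/-- `t` generates the maximal ideal of the valuation ring of `P` (a local parameter at `P`). -/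
def IsUniformizer (P : Place k K) (t : K) : Prop :=
  t ≠ 0 ∧ ∀ f : K, f ∈ P.ring.nonunits ↔ f / t ∈ P.ring

/-- `f = u t ^ n` with `t` a local parameter at `P` and `u` a unit of the valuation ring. -/
def IsOrd (P : Place k K) (f : K) (n : ℤ) : Prop :=
  ∃ t : K, P.IsUniformizer t ∧ P.ring.valuation f = P.ring.valuation t ^ n

/-- The order `v_P(f)` of a function `f ≠ 0` at `P`. -/
def ord (P : Place k K) (f : K) : ℤ :=
  Classical.epsilon fun n => P.IsOrd f n

/-- The order `v_P(ω)` of a differential `ω ≠ 0` at `P`: the order of `h`, where `ω = h dt`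
for a local parameter `t` at `P`. -/
def ordDiff (P : Place k K) (ω : KaehlerDifferential k K) : ℤ :=
  Classical.epsilon fun n =>
    ∃ t h : K, P.IsUniformizer t ∧ ω = h • KaehlerDifferential.D k K t ∧ P.IsOrd h n

/-- The value `f(P)` in the constant field, for `P` of degree one and `f` regular at `P`. -/
def eval (P : Place k K) (f : K) : k :=
  Classical.epsilon fun c => f - algebraMap k K c ∈ P.ring.nonunits

/-- `c` is the coefficient of `t⁻¹` in the expansion of `h` in powers of the local parameter `t`,
where `ω = h dt`. The principal part of the expansion is `p(t⁻¹)`. -/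
def IsResidue (P : Place k K) (ω : KaehlerDifferential k K) (c : k) : Prop :=
  ∃ (t h : K) (p : k[X]), P.IsUniformizer t ∧ ω = h • KaehlerDifferential.D k K t ∧
    h - aeval t⁻¹ p ∈ P.ring ∧ c = p.coeff 1

/-- The residue of a differential at a place of degree one. -/
def residue (P : Place k K) (ω : KaehlerDifferential k K) : k :=
  Classical.epsilon fun c => P.IsResidue ω c

end Place

namespace AGCode

variable {k K : Type*} [Field k] [Field K] [Algebra k K]

/-- `𝓛(A)`. -/
def L (A : Divisor k K) : Set K :=
  {f | f = 0 ∨ ∀ P : Place k K, -(A P) ≤ P.ord f}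

/-- `Ω(A)`. -/
def Omega (A : Divisor k K) : Set (KaehlerDifferential k K) :=
  {ω | ω = 0 ∨ ∀ P : Place k K, A P ≤ P.ordDiff ω}

/-- The divisor `D = ∑ i, Q i`. -/
def divisorSum {ι : Type*} [Fintype ι] (Q : ι → Place k K) : Divisor k K :=
  ∑ i, Finsupp.single (Q i) 1

/-- The functional code `C_L(D, A)` where `D = ∑ i, Q i`. -/
def functionalCode {ι : Type*} (Q : ι → Place k K) (A : Divisor k K) : Set (ι → k) :=
  (fun f i => (Q i).eval f) '' L A

/-- The differential code `C_Ω(D, A)` where `D = ∑ i, Q i`. -/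
def differentialCode {ι : Type*} [Fintype ι] (Q : ι → Place k K) (A : Divisor k K) :
    Set (ι → k) :=
  (fun ω i => (Q i).residue ω) '' Omega (A - divisorSum Q)

/-- Two codes are monomially equivalent if one is carried onto the other by a permutation of the
coordinates followed by multiplication of the coordinates by nonzero scalars. -/
def MonomiallyEquivalent {ι : Type*} (C C' : Set (ι → k)) : Prop :=
  ∃ (σ : Equiv.Perm ι) (w : ι → kˣ), C' = (fun c i => (w i : k) * c (σ i)) '' C

end AGCode

/-! ### The Hermitian curve `x ^ (q + 1) = y ^ q + y` over the field with `q ^ 2` elements -/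

namespace Hermitian

variable (q : ℕ) (F : Type*) [Field F]

/-- `X ^ (q + 1) - Y ^ q - Y`, where the coefficients are polynomials in `Y`. -/
def poly : F[X][X] := X ^ (q + 1) - C (X ^ q + X)

/-- The coordinate ring of the affine Hermitian curve. -/
abbrev CoordinateRing := AdjoinRoot (poly q F)

/-- The function field of the Hermitian curve. -/
def FunctionField := FractionRing (CoordinateRing q F)

variable {q F}

theorem two_le_q [Fintype F] (hq : Fintype.card F = q ^ 2) : 2 ≤ q := by
  have h1 : 1 < Fintype.card F := Fintype.one_lt_card
  rw [hq] at h1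
  by_contra h
  have h2 : q < 2 := by omega
  interval_cases q <;> simp at h1

theorem q_cast [Fintype F] (hq : Fintype.card F = q ^ 2) : (q : F) = 0 := by
  have h : ((Fintype.card F : ℕ) : F) = 0 := by simp
  rw [hq] at h
  push_cast at h
  exact (pow_eq_zero_iff two_ne_zero).1 h

theorem poly_monic : (poly q F).Monic := monic_X_pow_sub_C _ (Nat.succ_ne_zero q)

theorem poly_natDegree : (poly q F).natDegree = q + 1 := natDegree_X_pow_sub_C

theorem poly_irreducible (hq : 2 ≤ q) : Irreducible (poly q F) := by
  have hX : Prime (X : F[X]) := prime_X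
  have hP : (Ideal.span {(X : F[X])}).IsPrime := (Ideal.span_singleton_prime hX.ne_zero).2 hX
  refine irreducible_of_eisenstein_criterion hP ?_ ?_ ?_ ?_ poly_monic.isPrimitive
  · rw [poly_monic.leadingCoeff]
    exact fun h => hP.ne_top ((Ideal.eq_top_iff_one _).2 h)
  · intro n hn
    rw [degree_eq_natDegree poly_monic.ne_zero, poly_natDegree, Nat.cast_lt] at hn
    rw [poly, coeff_sub, coeff_X_pow, if_neg hn.ne, coeff_C, Ideal.mem_span_singleton]
    split_ifs
    · rw [zero_sub, dvd_neg]
      exact dvd_add (dvd_pow_self _ (by omega)) dvd_rfl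
    · simp
  · rw [degree_eq_natDegree poly_monic.ne_zero, poly_natDegree]
    exact_mod_cast Nat.succ_pos q
  · rw [poly, coeff_sub, coeff_X_pow, if_neg (by omega), coeff_C_zero, Ideal.span_singleton_pow,
      Ideal.mem_span_singleton, zero_sub, dvd_neg, X_pow_dvd_iff]
    intro h
    have := h 1 (by norm_num)
    rw [coeff_add, coeff_X_pow, if_neg (by omega), coeff_X_one, zero_add] at this
    exact one_ne_zero this

section

variable (q F) [Fintype F] [hq : Fact (Fintype.card F = q ^ 2)]

/-- `F` has `q ^ 2` elements, so that `q` is a prime power. -/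
instance : IsDomain (CoordinateRing q F) :=
  AdjoinRoot.isDomain_of_prime (poly_irreducible (two_le_q hq.out)).prime

instance : Field (FunctionField q F) := inferInstanceAs (Field (FractionRing (CoordinateRing q F)))

instance : Algebra (CoordinateRing q F) (FunctionField q F) :=
  inferInstanceAs (Algebra (CoordinateRing q F) (FractionRing (CoordinateRing q F)))

instance : IsFractionRing (CoordinateRing q F) (FunctionField q F) :=
  inferInstanceAs (IsFractionRing (CoordinateRing q F) (FractionRing (CoordinateRing q F)))

instance : Algebra F (FunctionField q F) :=
  inferInstanceAs (Algebra F (FractionRing (CoordinateRing q F)))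

instance : IsScalarTower F (CoordinateRing q F) (FunctionField q F) :=
  inferInstanceAs (IsScalarTower F (CoordinateRing q F) (FractionRing (CoordinateRing q F)))

/-- The coordinate function `x`. -/
def x : FunctionField q F := algebraMap (CoordinateRing q F) _ (AdjoinRoot.root _)

/-- The coordinate function `y`. -/
def y : FunctionField q F := algebraMap (CoordinateRing q F) _ (AdjoinRoot.of _ X)

end

variable (q F)

/-- The affine `F`-rational points `(a, b)` of the curve. -/
abbrev AffinePoint := {p : F × F // p.1 ^ (q + 1) = p.2 ^ q + p.2}

instance [Fintype F] : Fintype (AffinePoint q F) := Fintype.ofFinite _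

variable {q F}

/-- Evaluation of a polynomial function at an affine rational point. -/
def evalAt (S : AffinePoint q F) : CoordinateRing q F →ₐ[F] F :=
  AdjoinRoot.liftAlgHom (poly q F) (aeval S.1.2) S.1.1 (by
    rw [poly, eval₂_sub, eval₂_X_pow, eval₂_C]
    simp [S.2])

/-- The function `x - a` on the affine curve. -/
def param (S : AffinePoint q F) : CoordinateRing q F :=
  AdjoinRoot.root _ - algebraMap F _ S.1.1

theorem evalAt_param (S : AffinePoint q F) : evalAt S (param S) = 0 := by
  simp [param, evalAt]

section

variable [Fintype F] [hq : Fact (Fintype.card F = q ^ 2)]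

theorem equation : x q F ^ (q + 1) = y q F ^ q + y q F := by
  have h : AdjoinRoot.mk (poly q F) (X ^ (q + 1) - C (X ^ q + X)) = 0 := AdjoinRoot.mk_self
  rw [map_sub, sub_eq_zero, map_pow, AdjoinRoot.mk_X, AdjoinRoot.mk_C, map_add, map_pow] at h
  rw [x, y, ← map_pow, ← map_pow, ← map_add, h]

theorem y_transcendental (p : F[X]) (hp : aeval (y q F) p = 0) : p = 0 := by
  have h1 : aeval (y q F) p = algebraMap (CoordinateRing q F) _ (AdjoinRoot.of (poly q F) p) := by
    have : (aeval (y q F)) = ((Algebra.algHom F (CoordinateRing q F) (FunctionField q F)).comp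
        (Algebra.algHom F F[X] (CoordinateRing q F))) := by
      ext
      rw [aeval_X]
      rfl
    rw [this]
    rfl
  rw [h1, FaithfulSMul.algebraMap_eq_zero_iff] at hp
  refine AdjoinRoot.of.injective_of_degree_ne_zero ?_ (hp.trans (map_zero _).symm)
  rw [degree_eq_natDegree poly_monic.ne_zero, poly_natDegree]
  exact_mod_cast Nat.succ_ne_zero q

theorem y_ne_zero : y q F ≠ 0 := fun h => X_ne_zero (y_transcendental (F := F) (q := q) X (by simp [h]))

/-- The affine chart of the projective curve around `(0 : 1 : 0)`: with the affine coordinates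
`X / Y = x / y` and `Z / Y = 1 / y` the curve has the same equation, and the point `(0 : 1 : 0)`
is the origin. -/
def chartInf : CoordinateRing q F →ₐ[F] FunctionField q F :=
  AdjoinRoot.liftAlgHom (poly q F) (aeval (y q F)⁻¹) (x q F / y q F) (by
    have hy := y_ne_zero (q := q) (F := F)
    have h := equation (q := q) (F := F)
    change eval₂ _ _ (X ^ (q + 1) - C (X ^ q + X)) = 0
    rw [eval₂_sub, eval₂_X_pow, eval₂_C, div_pow, h]
    simp only [RingHom.coe_coe, map_add, map_pow, aeval_X, inv_pow]
    field_simp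
    ring)

theorem chartInf_injective : Function.Injective (chartInf (q := q) (F := F)) := by
  have := poly_monic (q := q) (F := F) |>.finite_adjoinRoot
  have h : RingHom.ker (chartInf (q := q) (F := F)) = ⊥ := by
    refine Ideal.eq_bot_of_comap_eq_bot (R := F[X]) (eq_bot_iff.2 fun p hp => ?_)
    rw [Ideal.mem_comap, RingHom.mem_ker, AdjoinRoot.algebraMap_eq, chartInf,
      AdjoinRoot.liftAlgHom_of] at hp
    have hy := y_ne_zero (q := q) (F := F)
    let := invertibleOfNonzero hy
    have h2 := (eval₂_reverse_eq_zero_iff (algebraMap F (FunctionField q F)) (⅟(y q F)) p).2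
      (by simpa [aeval_def] using hp)
    have h3 := y_transcendental (q := q) (reverse p) (by simpa [aeval_def] using h2)
    simpa using h3
  exact (RingHom.injective_iff_ker_eq_bot _).2 h

theorem chartInf_surjective (f : FunctionField q F) : ∃ g h, f = chartInf g / chartInf h := by
  let s : FunctionField q F →ₐ[F] FunctionField q F :=
    IsFractionRing.liftAlgHom (g := chartInf (q := q) (F := F)) chartInf_injective
  have hs : ∀ g, s (algebraMap _ _ g) = chartInf g := fun g =>
    IsFractionRing.lift_algebraMap (g := (chartInf (q := q) (F := F)).toRingHom)
      chartInf_injective g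
  have hy : y q F ≠ 0 := y_ne_zero
  have hsx : s (x q F) = x q F / y q F := (hs _).trans (by simp [chartInf])
  have hsy : s (y q F) = (y q F)⁻¹ := (hs _).trans (by simp [chartInf])
  have hpoly : ∀ p : F[X], s (s (algebraMap _ _ (AdjoinRoot.of (poly q F) p))) =
      algebraMap _ _ (AdjoinRoot.of (poly q F) p) := by
    intro p
    induction p using Polynomial.induction_on' with
    | add p r hp hr => simp only [map_add, hp, hr]
    | monomial n c =>
      rw [← C_mul_X_pow_eq_monomial]
      simp only [map_mul, map_pow]
      congr 1
      · exact (congrArg s (s.commutes c)).trans (s.commutes c)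
      · change s (s (y q F)) ^ n = y q F ^ n
        rw [hsy, map_inv₀, hsy, inv_inv]
  have hss : ∀ g, s (s (algebraMap (CoordinateRing q F) _ g)) = algebraMap _ _ g := by
    intro g
    obtain ⟨P, rfl⟩ := AdjoinRoot.mk_surjective g
    induction P using Polynomial.induction_on' with
    | add p r hp hr => simp only [map_add, hp, hr]
    | monomial n c =>
      rw [← C_mul_X_pow_eq_monomial]
      simp only [map_mul, map_pow, AdjoinRoot.mk_C, AdjoinRoot.mk_X, hpoly]
      congr 1
      change s (s (x q F)) ^ n = x q F ^ n
      rw [hsx, map_div₀, hsx, hsy]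
      field_simp
  obtain ⟨a, b, -, hab⟩ := IsFractionRing.div_surjective (CoordinateRing q F) (s f)
  obtain ⟨a', b', -, hab'⟩ := IsFractionRing.div_surjective (CoordinateRing q F) f
  refine ⟨a, b, ?_⟩
  rw [← hs, ← hs, ← map_div₀, hab, ← hab']
  simp only [map_div₀, hss]

theorem param_ne_zero (S : AffinePoint q F) : param S ≠ 0 := by
  have h : param S = AdjoinRoot.mk (poly q F) (X - C (C S.1.1)) := by
    rw [param, map_sub, AdjoinRoot.mk_X, AdjoinRoot.mk_C]
    rfl
  rw [h, Ne, AdjoinRoot.mk_eq_zero]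
  intro h'
  have h2 := natDegree_le_of_dvd h' (X_sub_C_ne_zero _)
  rw [poly_natDegree, natDegree_X_sub_C] at h2
  have := two_le_q hq.out
  omega

theorem smooth (S : AffinePoint q F) (g : CoordinateRing q F) (hg : evalAt S g = 0) :
    ∃ s c : CoordinateRing q F, evalAt S s ≠ 0 ∧ s * g = c * param S := by
  obtain ⟨⟨⟨a, b⟩, hab⟩, rfl⟩ : ∃ S' : AffinePoint q F, S' = S := ⟨S, rfl⟩
  have hab' : a ^ (q + 1) = b ^ q + b := hab
  set S : AffinePoint q F := ⟨(a, b), hab⟩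
  obtain ⟨P, rfl⟩ := AdjoinRoot.mk_surjective g
  set x' : CoordinateRing q F := AdjoinRoot.root (poly q F)
  set y' : CoordinateRing q F := AdjoinRoot.of (poly q F) X
  have hS1 : evalAt S x' = a := by simp [evalAt, x', S]
  have hS2 : evalAt S y' = b := by simp [evalAt, y', S]
  have heq : x' ^ (q + 1) = y' ^ q + y' := by
    have h : AdjoinRoot.mk (poly q F) (X ^ (q + 1) - C (X ^ q + X)) = 0 := AdjoinRoot.mk_self
    rw [map_sub, sub_eq_zero, map_pow, AdjoinRoot.mk_X, AdjoinRoot.mk_C, map_add, map_pow] at h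
    exact h
  have hP : ∃ r : F[X], ∃ u : CoordinateRing q F, AdjoinRoot.mk (poly q F) P =
      AdjoinRoot.of (poly q F) r + param S * u := by
    obtain ⟨Q, hQ⟩ := X_sub_C_dvd_sub_C_eval (p := P) (a := C a)
    refine ⟨P.eval (C a), AdjoinRoot.mk _ Q, ?_⟩
    have h2 := congrArg (AdjoinRoot.mk (poly q F)) hQ
    rw [map_mul, map_sub, map_sub, AdjoinRoot.mk_X, AdjoinRoot.mk_C, AdjoinRoot.mk_C] at h2
    rw [← sub_eq_iff_eq_add', h2]
    rfl
  obtain ⟨r, u, hru⟩ := hP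
  have hr : r.eval b = 0 := by
    have h3 := hg
    rw [hru, map_add, map_mul, evalAt_param, zero_mul, add_zero, evalAt,
      AdjoinRoot.liftAlgHom_of] at h3
    simpa [aeval_def, eval₂_eq_eval_map] using h3
  obtain ⟨r', hr'⟩ := dvd_iff_isRoot.2 hr
  obtain ⟨A, hA⟩ := sub_dvd_pow_sub_pow x' (algebraMap F _ a) (q + 1)
  have hB := (Commute.all y' (algebraMap F (CoordinateRing q F) b)).geom_sum₂_mul q
  set B := ∑ i ∈ Finset.range q, y' ^ i * (algebraMap F (CoordinateRing q F) b) ^ (q - 1 - i)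
  have hBev : evalAt S B = 0 := by
    simp only [B, map_sum, map_mul, map_pow, hS2, AlgHom.commutes, Algebra.algebraMap_self,
      RingHom.id_apply]
    have : ∀ i ∈ Finset.range q, b ^ i * b ^ (q - 1 - i) = b ^ (q - 1) := by
      intro i hi
      rw [← pow_add]
      congr 1
      have := Finset.mem_range.1 hi
      omega
    rw [Finset.sum_congr rfl this]
    simp [q_cast hq.out]
  have hab'' : (algebraMap F (CoordinateRing q F) a) ^ (q + 1) =
      (algebraMap F (CoordinateRing q F) b) ^ q + algebraMap F (CoordinateRing q F) b := by
    rw [← map_pow, ← map_pow, ← map_add, hab']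
  have hof : AdjoinRoot.of (poly q F) r =
      (y' - algebraMap F _ b) * AdjoinRoot.of (poly q F) r' := by
    rw [hr', map_mul, map_sub]
    rfl
  have hpar : param S = x' - algebraMap F _ a := rfl
  refine ⟨B + 1, A * AdjoinRoot.of (poly q F) r' + (B + 1) * u, ?_, ?_⟩
  · rw [map_add, hBev, map_one, zero_add]
    exact one_ne_zero
  · rw [hru, hof, hpar]
    linear_combination (AdjoinRoot.of (poly q F) r') * (hB + hab'' - heq + hA)

theorem exists_div (S : AffinePoint q F) (g h : CoordinateRing q F) :
    ∃ c s : CoordinateRing q F, evalAt S s ≠ 0 ∧ (s * h = g * c ∨ s * g = h * c) := by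
  let M := RingHom.ker (evalAt S)
  have hM : M.IsPrime := RingHom.ker_isPrime _
  have : IsNoetherianRing (CoordinateRing q F) :=
    Ideal.Quotient.isNoetherianRing (R := F[X][X]) _
  let Lo := Localization.AtPrime M
  have : IsNoetherianRing Lo := IsLocalization.isNoetherianRing M.primeCompl Lo inferInstance
  have : IsDomain Lo := IsLocalization.isDomain_localization M.primeCompl_le_nonZeroDivisors
  have hpr : (IsLocalRing.maximalIdeal Lo).IsPrincipal := by
    refine ⟨algebraMap _ Lo (param S), ?_⟩
    rw [← Localization.AtPrime.map_eq_maximalIdeal]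
    apply le_antisymm
    · rw [Ideal.map_le_iff_le_comap]
      intro f hf
      obtain ⟨s, c, hs, hsc⟩ := smooth S f hf
      rw [Ideal.mem_comap]
      refine Ideal.mem_span_singleton.2 ?_
      have hu : IsUnit (algebraMap (CoordinateRing q F) Lo s) :=
        IsLocalization.map_units Lo (⟨s, hs⟩ : M.primeCompl)
      rw [← hu.dvd_mul_left, ← map_mul, hsc, map_mul]
      exact Dvd.intro_left _ rfl
    · refine (Ideal.span_singleton_le_iff_mem _).2 ?_
      exact Ideal.mem_map_of_mem _ (evalAt_param S)
  have hV : ValuationRing Lo :=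
    ((tfae_of_isNoetherianRing_of_isLocalRing_of_isDomain Lo).out 4 1).1 hpr
  have hinj : Function.Injective (algebraMap (CoordinateRing q F) Lo) :=
    IsLocalization.injective _ M.primeCompl_le_nonZeroDivisors
  have key : ∀ g h : CoordinateRing q F, algebraMap _ Lo g ∣ algebraMap _ Lo h →
      ∃ c s, evalAt S s ≠ 0 ∧ s * h = g * c := by
    rintro g h ⟨w, hw⟩
    obtain ⟨⟨c, s⟩, hcs⟩ := IsLocalization.surj M.primeCompl w
    refine ⟨c, s, s.2, hinj ?_⟩
    rw [map_mul, map_mul, hw, ← hcs]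
    ring
  rcases ValuationRing.dvd_total (algebraMap _ Lo g) (algebraMap _ Lo h) with hd | hd
  · obtain ⟨c, s, hs, e⟩ := key _ _ hd
    exact ⟨c, s, hs, Or.inl e⟩
  · obtain ⟨c, s, hs, e⟩ := key _ _ hd
    exact ⟨c, s, hs, Or.inr e⟩

/-- For a chart `ψ` of the curve with the coordinate ring of the affine curve, the local ring
`{g / h : h(S) ≠ 0}` of the curve at the point `S` of the chart. -/
def localRing (ψ : CoordinateRing q F →ₐ[F] FunctionField q F) (hψ : Function.Injective ψ)
    (hψ' : ∀ f, ∃ g h, f = ψ g / ψ h) (S : AffinePoint q F) : ValuationSubring (FunctionField q F) where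
  carrier := {f | ∃ g h : CoordinateRing q F, evalAt S h ≠ 0 ∧ f = ψ g / ψ h}
  mul_mem' := by
    rintro _ _ ⟨g, h, hh, rfl⟩ ⟨g', h', hh', rfl⟩
    exact ⟨g * g', h * h', by simp [hh, hh'], by simp [div_mul_div_comm]⟩
  one_mem' := ⟨1, 1, by simp, by simp⟩
  add_mem' := by
    rintro _ _ ⟨g, h, hh, rfl⟩ ⟨g', h', hh', rfl⟩
    have h1 : ψ h ≠ 0 := (map_ne_zero_iff ψ hψ).2 (by rintro rfl; simp at hh)
    have h2 : ψ h' ≠ 0 := (map_ne_zero_iff ψ hψ).2 (by rintro rfl; simp at hh')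
    refine ⟨g * h' + h * g', h * h', by simp [hh, hh'], ?_⟩
    simp [div_add_div _ _ h1 h2]
  zero_mem' := ⟨0, 1, by simp, by simp⟩
  neg_mem' := by
    rintro _ ⟨g, h, hh, rfl⟩
    exact ⟨-g, h, hh, by simp [neg_div]⟩
  mem_or_inv_mem' f := by
    obtain ⟨g, h, rfl⟩ := hψ' f
    by_cases hg : ψ g = 0
    · exact Or.inl ⟨0, 1, by simp, by simp [hg]⟩
    by_cases h0 : ψ h = 0
    · exact Or.inl ⟨0, 1, by simp, by simp [h0]⟩
    obtain ⟨c, s, hs, e⟩ := exists_div S g h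
    have h3 : ψ s ≠ 0 := (map_ne_zero_iff ψ hψ).2 (by rintro rfl; simp at hs)
    rcases e with e | e
    · refine Or.inr ⟨c, s, hs, ?_⟩
      have e' := congrArg ψ e
      rw [map_mul, map_mul] at e'
      rw [inv_div]
      field_simp
      linear_combination e'
    · refine Or.inl ⟨c, s, hs, ?_⟩
      have e' := congrArg ψ e
      rw [map_mul, map_mul] at e'
      field_simp
      linear_combination e'

/-- The place with valuation ring `localRing ψ hψ hψ' S`. -/
def placeOf (ψ : CoordinateRing q F →ₐ[F] FunctionField q F) (hψ : Function.Injective ψ)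
    (hψ' : ∀ f, ∃ g h, f = ψ g / ψ h) (S : AffinePoint q F) : Place F (FunctionField q F) where
  ring := localRing ψ hψ hψ' S
  algebraMap_mem c := ⟨algebraMap F _ c, 1, by simp, by simp⟩
  ne_top := by
    intro h
    have h1 : (ψ (param S))⁻¹ ∈ localRing ψ hψ hψ' S := h ▸ ValuationSubring.mem_top _
    obtain ⟨g, s, hs, h2⟩ := h1
    have h3 : ψ s ≠ 0 := (map_ne_zero_iff ψ hψ).2 (by rintro rfl; simp at hs)
    have h4 : ψ (param S) ≠ 0 := (map_ne_zero_iff ψ hψ).2 (param_ne_zero S)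
    have h5 : ψ s = ψ (param S * g) := by
      rw [map_mul]
      field_simp at h2
      exact h2
    exact hs (by rw [hψ h5, map_mul, evalAt_param, zero_mul])

/-- The place at the affine rational point `S`. -/
def place (S : AffinePoint q F) : Place F (FunctionField q F) :=
  placeOf (Algebra.algHom F (CoordinateRing q F) (FunctionField q F))
    (IsFractionRing.injective _ _)
    (fun f => by
      obtain ⟨g, h, -, e⟩ := IsFractionRing.div_surjective (CoordinateRing q F) f
      exact ⟨g, h, e.symm⟩) S

/-- The place `P_∞` at the point `(0 : 1 : 0)`. -/
def placeInf : Place F (FunctionField q F) :=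
  placeOf chartInf chartInf_injective chartInf_surjective
    ⟨(0, 0), by simp [zero_pow (show q ≠ 0 by have := two_le_q hq.out; omega)]⟩

variable (q F)

open Classical in
/-- The elements `c` of `F` with `c ^ q + c ≠ 0`. -/
def traceNonzero : Finset F := Finset.univ.filter fun c => c ^ q + c ≠ 0

/-- `R(x, y) = x ∏ (y - c)`, over all `c` with `c ^ q + c ≠ 0`. -/
def R : FunctionField q F := x q F * ∏ c ∈ traceNonzero q F, (y q F - algebraMap F _ c)

variable {q F}

open Classical in
/-- The coefficient `u` of the expansion `R = u (x - a) + ⋯` at the point `(a, b)`. -/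
def weight (S : AffinePoint q F) : F :=
  if S.1.1 = 0 then ∏ c ∈ traceNonzero q F, (S.1.2 - c)
  else S.1.1 ^ (q + 1) * ∏ c ∈ (traceNonzero q F).erase S.1.2, (S.1.2 - c)

end

end Hermitian

end

/-! The key is that `R = x ^ (q ^ 2) - x`. The product of the `Y - c` with `c ^ q + c ≠ 0` is the
cofactor of `Y ^ q + Y` in `Y ^ (q ^ 2) - Y`, while the equation of the curve gives `y ^ q + y = x ^
(q + 1)` and `y ^ (q ^ 2) - y = x ^ q (x ^ (q ^ 2) - x)`; cancelling `x ^ q` leaves `R_eq`. Hence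
`dR = -dx`, and `dx / R = -dR / R` is a logarithmic differential: wherever `R` vanishes on the
affine curve it is a local parameter, and the residue of `dx / R` is `-1`. The affine zeros of `R`
are exactly the rational points, and `u` is identically `-1` (`weight_eq`).

On the affine curve `dx` has neither zeros nor poles, since `Y ^ q + Y` has derivative `1`. At `P_∞`
the chart `z = x / y`, `w = 1 / y` has the same equation, `z` is a local parameter and `w` has order
`q + 1`; this gives order `-q ^ 3` for `R` and `q ^ 2 - q - 2` for `dx`. Altogether `div(dx / R) =
(q ^ 3 + q ^ 2 - q - 2) P_∞ - D` (`ordDiff_smul_D_x`). As `dx` spans the differentials,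
multiplication by `dx / R` carries `𝓛(E)` onto `Ω(G - D)`, and the residues follow from
`residue_place`.

A place is here an arbitrary valuation ring, and orders and residues are chosen values, so it must
be shown that they are well defined. This is the role of `Place.IsCoordinate`: a function `z` with a
derivation `d / dz` that is regular at `P`, together with a local parameter on which the derivation
is a unit. Every place is centred on the affine chart or is `P_∞`, and
`exists_isCoordinate_of_chart` treats both charts at once, using that the curve is unramified over
the line of its first coordinate. -/

/-! ### Local parameters from unramifiedness over the `x`-line -/

/-- The curve `x ^ (q + 1) = y ^ q + y` is unramified over the `x`-line, so that the maximal ideal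
of its local ring at a closed point is generated by a separable polynomial in `x`. -/
theorem exists_separable_local_parameter {k A : Type*} [Field k] [PerfectField k] [CommRing A]
    [IsDomain A] [Algebra k A] {q : ℕ} (hq : (q : k) = 0) {x y : A}
    (hxy : x ^ (q + 1) = y ^ q + y) (hgen : Algebra.adjoin k {x, y} = ⊤)
    (p : Ideal A) [p.IsPrime] (hp : p ≠ ⊥) :
    ∃ π : k[X], aeval x π ∈ p ∧ aeval x (derivative π) ∉ p ∧
      ∀ g : A, g ≠ 0 → ∃ (n : ℕ) (s s' : A), s ∉ p ∧ s' ∉ p ∧ s * g = s' * aeval x π ^ n := by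
  let := (aeval (R := k) x).toAlgebra
  have halg : ∀ f : k[X], algebraMap k[X] A f = aeval x f := fun f => rfl
  have : IsScalarTower k k[X] A := IsScalarTower.of_algebraMap_eq fun r => by
    rw [halg, Polynomial.algebraMap_apply, aeval_C]; rfl
  have hft : Algebra.FiniteType k A := by
    classical exact ⟨⟨({x, y} : Finset A), by simpa using hgen⟩⟩
  have hft' : Algebra.FiniteType k[X] A := Algebra.FiniteType.of_restrictScalars_finiteType k _ _
  -- The relative differentials vanish: `dx = 0`, and differentiating the equation leaves `dy = 0`
  -- because `q = 0` in `k`.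
  have hunr : Algebra.FormallyUnramified k[X] A := by
    constructor
    have hx : KaehlerDifferential.D k[X] A x = 0 := by
      have : x = algebraMap k[X] A X := by rw [halg, aeval_X]
      rw [this, Derivation.map_algebraMap]
    have hqA : (q : A) = 0 := by rw [← map_natCast (algebraMap k A), hq, map_zero]
    have hy : KaehlerDifferential.D k[X] A y = 0 := by
      have h := congrArg (KaehlerDifferential.D k[X] A) hxy
      rw [Derivation.leibniz_pow, hx, map_add, Derivation.leibniz_pow,
        ← Nat.cast_smul_eq_nsmul A q, hqA] at h
      simpa using h.symm
    have h0 : ∀ a : A, KaehlerDifferential.D k[X] A a = 0 := by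
      intro a
      have ha : a ∈ Algebra.adjoin k {x, y} := hgen ▸ Algebra.mem_top
      refine Derivation.eqOn_adjoin (D1 := (KaehlerDifferential.D k[X] A).restrictScalars k)
        (D2 := 0) ?_ ha
      rintro z (rfl | rfl)
      · exact hx
      · exact hy
    rw [← not_nontrivial_iff_subsingleton, ← Submodule.nontrivial_iff A,
      not_nontrivial_iff_subsingleton, ← subsingleton_iff_bot_eq_top,
      ← KaehlerDifferential.span_range_derivation, eq_comm, Submodule.span_eq_bot]
    rintro _ ⟨a, rfl⟩
    exact h0 a
  let := Localization.AtPrime.algebraOfLiesOver (p.under k[X]) p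
  -- Unramifiedness makes the maximal ideal of `A_p` the extension of `p ∩ k[X]`, an ideal of a
  -- principal ideal domain; its generator is `π`.
  have hmap : (p.under k[X]).map (algebraMap k[X] (Localization.AtPrime p)) =
      IsLocalRing.maximalIdeal _ :=
    ((Algebra.isUnramifiedAt_iff_map_eq k[X] (p.under k[X]) p).1
      (inferInstanceAs (Algebra.FormallyUnramified k[X] (Localization.AtPrime p)))).2
  obtain ⟨π, hπ⟩ := (IsPrincipalIdealRing.principal (p.under k[X])).principal
  have hinj : Function.Injective (algebraMap A (Localization.AtPrime p)) :=
    IsLocalization.injective _ p.primeCompl_le_nonZeroDivisors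
  have hmax : ∀ a : A, algebraMap A (Localization.AtPrime p) a ∈
      IsLocalRing.maximalIdeal (Localization.AtPrime p) ↔ a ∈ p := fun a =>
    IsLocalization.AtPrime.to_map_mem_maximal_iff _ p a
  have hspan : IsLocalRing.maximalIdeal (Localization.AtPrime p) =
      Ideal.span {algebraMap A (Localization.AtPrime p) (aeval x π)} := by
    rw [← hmap, hπ, ← Ideal.span, Ideal.map_span, Set.image_singleton,
      IsScalarTower.algebraMap_apply k[X] A, halg]
  have hπp : aeval x π ∈ p := by
    rw [← hmax, hspan]
    exact Ideal.mem_span_singleton_self _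
  have hπ0 : π ≠ 0 := by
    rintro rfl
    obtain ⟨a, ha, ha0⟩ := Submodule.exists_mem_ne_zero_of_ne_bot hp
    rw [← hmax, hspan, map_zero, map_zero, Ideal.mem_span_singleton, zero_dvd_iff] at ha
    exact ha0 (hinj (ha.trans (map_zero _).symm))
  have hirr : Irreducible π := by
    refine Prime.irreducible ((Ideal.span_singleton_prime hπ0).1 ?_)
    rw [Ideal.span, ← hπ]
    infer_instance
  refine ⟨π, hπp, fun hd => ?_, fun g hg => ?_⟩
  -- A Bézout relation between `π` and its derivative would put `1` into `p`.
  · obtain ⟨a, b, hab⟩ := PerfectField.separable_of_irreducible hirr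
    refine ‹p.IsPrime›.ne_top ((Ideal.eq_top_iff_one _).2 ?_)
    rw [← map_one (aeval (R := k) x), ← hab, map_add, map_mul, map_mul]
    exact p.add_mem (p.mul_mem_left _ hπp) (p.mul_mem_left _ hd)
  · have : IsNoetherianRing A := Algebra.FiniteType.isNoetherianRing k A
    have : IsNoetherianRing (Localization.AtPrime p) :=
      IsLocalization.isNoetherianRing p.primeCompl _ inferInstance
    have : IsDomain (Localization.AtPrime p) :=
      IsLocalization.isDomain_localization p.primeCompl_le_nonZeroDivisors
    have hnu : ¬ IsUnit (algebraMap A (Localization.AtPrime p) (aeval x π)) :=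
      (IsLocalRing.mem_maximalIdeal _).1 ((hmax _).2 hπp)
    -- Split off the largest power of `π(x)` in the Noetherian domain `A_p`. The remaining factor is
    -- not divisible by the generator of the maximal ideal, so it is a unit.
    obtain ⟨n, c, hc, e⟩ := WfDvdMonoid.max_power_factor'
      ((map_ne_zero_iff _ hinj).2 hg) hnu
    obtain ⟨⟨s', s⟩, hs⟩ := IsLocalization.surj p.primeCompl c
    refine ⟨n, s, s', s.2, fun h => hc ?_, hinj ?_⟩
    · rw [← hmax, ← hs, (IsLocalRing.maximalIdeal.isMaximal _).isPrime.mul_mem_iff_mem_or_mem] at h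
      rcases h with h | h
      · rwa [hspan, Ideal.mem_span_singleton] at h
      · exact absurd ((hmax _).1 h) s.2
    · simp only [map_mul, map_pow, e] at hs ⊢
      rw [← hs]
      ring

/-! ### Orders and residues at a place, computed with a coordinate -/

namespace Place

variable {k K : Type*} [Field k] [Field K] [Algebra k K] {P : Place k K}

theorem ext_ring {P Q : Place k K} (h : P.ring = Q.ring) : P = Q := by
  cases P; cases Q; congr

theorem mem_ring_iff {f : K} : f ∈ P.ring ↔ P.ring.valuation f ≤ 1 :=
  (P.ring.valuation_le_one_iff f).symm

theorem mem_nonunits_iff {f : K} : f ∈ P.ring.nonunits ↔ P.ring.valuation f < 1 :=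
  P.ring.mem_nonunits_iff

theorem algebraMap_mem_nonunits_iff {c : k} : algebraMap k K c ∈ P.ring.nonunits ↔ c = 0 := by
  rw [ValuationSubring.mem_nonunits_iff_or, ← map_inv₀]
  have := P.algebraMap_mem c⁻¹
  simp_all

namespace IsUniformizer

variable {t t' : K}

theorem valuation_pos (ht : P.IsUniformizer t) : 0 < P.ring.valuation t :=
  zero_lt_iff.2 ((Valuation.ne_zero_iff _).2 ht.1)

theorem mem_nonunits_iff_le (ht : P.IsUniformizer t) {f : K} :
    f ∈ P.ring.nonunits ↔ P.ring.valuation f ≤ P.ring.valuation t := by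
  rw [ht.2, mem_ring_iff, map_div₀, div_le_one₀ ht.valuation_pos]

theorem mem_nonunits (ht : P.IsUniformizer t) : t ∈ P.ring.nonunits :=
  ht.mem_nonunits_iff_le.2 le_rfl

theorem valuation_lt_one (ht : P.IsUniformizer t) : P.ring.valuation t < 1 :=
  mem_nonunits_iff.1 ht.mem_nonunits

theorem valuation_eq (ht : P.IsUniformizer t) (ht' : P.IsUniformizer t') :
    P.ring.valuation t = P.ring.valuation t' :=
  le_antisymm (ht'.mem_nonunits_iff_le.1 ht.mem_nonunits)
    (ht.mem_nonunits_iff_le.1 ht'.mem_nonunits)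

theorem of_valuation_eq (ht : P.IsUniformizer t)
    (h : P.ring.valuation t = P.ring.valuation t') : P.IsUniformizer t' := by
  refine ⟨fun h0 => ht.1 (by simpa [h0] using h), fun f => ?_⟩
  rw [ht.2, mem_ring_iff, mem_ring_iff, map_div₀, map_div₀, h]

theorem zpow_le_zpow_iff (ht : P.IsUniformizer t) {m n : ℤ} :
    P.ring.valuation t ^ m ≤ P.ring.valuation t ^ n ↔ n ≤ m :=
  zpow_le_zpow_iff_right_of_lt_one₀ ht.valuation_pos ht.valuation_lt_one

/-- All local parameters have the same valuation, so the one hidden in `IsOrd` may be replaced by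
any other. -/
theorem isOrd_iff (ht : P.IsUniformizer t) {f : K} {n : ℤ} :
    P.IsOrd f n ↔ P.ring.valuation f = P.ring.valuation t ^ n :=
  ⟨fun ⟨_, ht', h⟩ => ht.valuation_eq ht' ▸ h, fun h => ⟨t, ht, h⟩⟩

theorem isOrd_unique (ht : P.IsUniformizer t) {f : K} {m n : ℤ} (hm : P.IsOrd f m)
    (hn : P.IsOrd f n) : m = n := by
  have h := (ht.isOrd_iff.1 hm).symm.trans (ht.isOrd_iff.1 hn)
  exact le_antisymm (ht.zpow_le_zpow_iff.1 h.ge) (ht.zpow_le_zpow_iff.1 h.le)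

/-- A polynomial in `t⁻¹` which is regular at `P` is constant. -/
theorem aeval_inv_not_mem_nonunits (ht : P.IsUniformizer t) (p : k[X]) (hp : p ≠ 0) :
    aeval t⁻¹ p ∉ P.ring.nonunits := by
  induction hn : p.natDegree using Nat.strong_induction_on generalizing p with
  | _ n ih =>
    have hdec : aeval t⁻¹ p = aeval t⁻¹ p.divX * t⁻¹ + algebraMap k K (p.coeff 0) := by
      conv_lhs => rw [← divX_mul_X_add p]
      simp
    by_cases h0 : p.divX = 0
    · rw [hdec, h0, map_zero, zero_mul, zero_add, algebraMap_mem_nonunits_iff]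
      intro h
      apply hp
      rw [← divX_mul_X_add p, h0, h]
      simp
    · have hlt : p.divX.natDegree < n := by
        rw [natDegree_divX_eq_natDegree_tsub_one, ← hn]
        have : p.natDegree ≠ 0 := fun h => h0 (divX_eq_zero_iff.2 (eq_C_of_natDegree_eq_zero h))
        omega
      -- If `p(t⁻¹)` were in the maximal ideal, subtracting the constant term would make
      -- `p.divX(t⁻¹) / t` regular, so that `p.divX(t⁻¹)` would vanish at `P`, against the induction
      -- hypothesis.
      have h1 := ih _ hlt _ h0 rfl
      rw [ht.2, div_eq_mul_inv] at h1
      intro h2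
      refine h1 ?_
      rw [← add_sub_cancel_right (aeval t⁻¹ p.divX * t⁻¹) (algebraMap k K (p.coeff 0)), ← hdec]
      exact sub_mem (P.ring.nonunits_subset h2) (P.algebraMap_mem _)

end IsUniformizer

/-- If `h` has at most a simple pole with principal part `p(t⁻¹)`, then `t h` takes the value
`p.coeff 1`. -/
theorem IsUniformizer.mul_sub_coeff_one_mem {t h : K} (ht : P.IsUniformizer t) {p : k[X]}
    (hp : h - aeval t⁻¹ p ∈ P.ring) (hth : t * h ∈ P.ring) :
    t * h - algebraMap k K (p.coeff 1) ∈ P.ring.nonunits := by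
  have htO : t ∈ P.ring := P.ring.nonunits_subset ht.mem_nonunits
  have hdec : aeval t⁻¹ p = (aeval t⁻¹ p.divX.divX * t⁻¹ + algebraMap k K (p.coeff 1)) * t⁻¹ +
      algebraMap k K (p.coeff 0) := by
    conv_lhs => rw [← divX_mul_X_add p, ← divX_mul_X_add p.divX]
    simp [coeff_divX]
  have ht0 := ht.1
  have hmem : t * h - aeval t⁻¹ p.divX.divX * t⁻¹ - algebraMap k K (p.coeff 1) ∈
      P.ring.nonunits := by
    rw [ht.2]
    have : (t * h - aeval t⁻¹ p.divX.divX * t⁻¹ - algebraMap k K (p.coeff 1)) / t =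
        (h - aeval t⁻¹ p) + algebraMap k K (p.coeff 0) := by
      rw [hdec]
      field_simp
      ring
    rw [this]
    exact add_mem hp (P.algebraMap_mem _)
  -- A pole of order at least two would give a nonzero polynomial in `t⁻¹` that lies in the maximal
  -- ideal.
  have h2 : p.divX.divX = 0 := by
    by_contra h0
    refine ht.aeval_inv_not_mem_nonunits _ h0 ?_
    rw [ht.2, div_eq_mul_inv]
    have := sub_mem (sub_mem hth (P.ring.nonunits_subset hmem)) (P.algebraMap_mem (p.coeff 1))
    convert this using 1
    ring
  rwa [h2, map_zero, zero_mul, sub_zero] at hmem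

/-- `δ` is the derivation `d / dz`, it is regular at `P`, and every function is, up to a unit at
`P`, a power of a local parameter `t` such that `dt / dz` is a unit at `P`. -/
structure IsCoordinate (P : Place k K) (z : K) (δ : Derivation k K K) : Prop where
  D_eq : ∀ f, KaehlerDifferential.D k K f = δ f • KaehlerDifferential.D k K z
  apply_self : δ z = 1
  map_mem : ∀ f ∈ P.ring, δ f ∈ P.ring
  exists_uniformizer : ∃ t, P.IsUniformizer t ∧ δ t ∉ P.ring.nonunits ∧
    ∀ f, f ≠ 0 → ∃ n : ℤ, P.ring.valuation f = P.ring.valuation t ^ n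

namespace IsCoordinate

variable {z : K} {δ : Derivation k K K}

/-- The linear functional on differentials induced by `δ` sends `dz` to `1`. -/
theorem smul_D_injective (hP : P.IsCoordinate z δ) {f g : K}
    (h : f • KaehlerDifferential.D k K z = g • KaehlerDifferential.D k K z) : f = g := by
  have h1 := congrArg δ.liftKaehlerDifferential h
  simpa [hP.apply_self] using h1

theorem exists_eq_smul_D (hP : P.IsCoordinate z δ) (ω : KaehlerDifferential k K) :
    ∃ h : K, ω = h • KaehlerDifferential.D k K z := by
  have hω : ω ∈ Submodule.span K (Set.range (KaehlerDifferential.D k K)) :=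
    KaehlerDifferential.span_range_derivation k K ▸ Submodule.mem_top
  induction hω using Submodule.span_induction with
  | mem _ h =>
    obtain ⟨f, rfl⟩ := h
    exact ⟨_, hP.D_eq f⟩
  | zero => exact ⟨0, by simp⟩
  | add _ _ _ _ h1 h2 =>
    obtain ⟨a, rfl⟩ := h1
    obtain ⟨b, rfl⟩ := h2
    exact ⟨a + b, by rw [add_smul]⟩
  | smul c _ _ h =>
    obtain ⟨a, rfl⟩ := h
    exact ⟨c * a, by rw [mul_smul]⟩

/-- Two local parameters differ by a unit `w`. In `δ (w s) = w δ s + s δ w` the last term lies in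
the maximal ideal because `δ w` is regular, so `δ (w s)` is a unit when `δ s` is. -/
theorem valuation_apply_uniformizer (hP : P.IsCoordinate z δ) {t : K} (ht : P.IsUniformizer t) :
    P.ring.valuation (δ t) = 1 := by
  obtain ⟨s, hs, hδs, -⟩ := hP.exists_uniformizer
  have hδs' : P.ring.valuation (δ s) = 1 := by
    refine le_antisymm ?_ (not_lt.1 fun h => hδs (mem_nonunits_iff.2 h))
    exact mem_ring_iff.1 (hP.map_mem _ (P.ring.nonunits_subset hs.mem_nonunits))
  have hw : P.ring.valuation (t / s) = 1 := by
    rw [map_div₀, ht.valuation_eq hs, div_self hs.valuation_pos.ne']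
  have e : δ t = (t / s) * δ s + s * δ (t / s) := by
    conv_lhs => rw [← div_mul_cancel₀ t hs.1, Derivation.leibniz, smul_eq_mul, smul_eq_mul]
  have h1 : P.ring.valuation (t / s * δ s) = 1 := by rw [map_mul, hw, hδs', one_mul]
  have h2 : P.ring.valuation (s * δ (t / s)) < 1 := by
    rw [map_mul]
    exact mul_lt_one_of_lt_of_le hs.valuation_lt_one
      (mem_ring_iff.1 (hP.map_mem _ (mem_ring_iff.2 hw.le)))
  rw [e, Valuation.map_add_eq_of_lt_left _ (h1.symm ▸ h2), h1]

/-- A function vanishing to order at least two has a derivative that still vanishes at `P`. -/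
theorem isUniformizer_of_apply_not_mem (hP : P.IsCoordinate z δ) {f : K}
    (hf : f ∈ P.ring.nonunits) (hδf : δ f ∉ P.ring.nonunits) : P.IsUniformizer f := by
  obtain ⟨t, ht, -, -⟩ := hP.exists_uniformizer
  have hw : f / t ∈ P.ring := (ht.2 f).1 hf
  have e : δ f = (f / t) * δ t + t * δ (f / t) := by
    conv_lhs => rw [← div_mul_cancel₀ f ht.1, Derivation.leibniz, smul_eq_mul, smul_eq_mul]
  refine ht.of_valuation_eq (le_antisymm (not_lt.1 fun hlt => hδf ?_) (ht.mem_nonunits_iff_le.1 hf))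
  rw [mem_nonunits_iff, e]
  refine Valuation.map_add_lt _ ?_ ?_
  · rw [map_mul, hP.valuation_apply_uniformizer ht, mul_one, map_div₀]
    exact (div_lt_one₀ ht.valuation_pos).2 hlt
  · rw [map_mul]
    exact mul_lt_one_of_lt_of_le ht.valuation_lt_one (mem_ring_iff.1 (hP.map_mem _ hw))

theorem isOrd_ord (hP : P.IsCoordinate z δ) {f : K} (hf : f ≠ 0) : P.IsOrd f (P.ord f) := by
  obtain ⟨t, ht, -, h⟩ := hP.exists_uniformizer
  obtain ⟨n, hn⟩ := h f hf
  exact Classical.epsilon_spec (p := fun n => P.IsOrd f n) ⟨n, t, ht, hn⟩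

theorem ord_eq (hP : P.IsCoordinate z δ) {f : K} (hf : f ≠ 0) {n : ℤ} (h : P.IsOrd f n) :
    P.ord f = n := by
  obtain ⟨t, ht, -, -⟩ := hP.exists_uniformizer
  exact ht.isOrd_unique (hP.isOrd_ord hf) h

theorem ord_mul (hP : P.IsCoordinate z δ) {f g : K} (hf : f ≠ 0) (hg : g ≠ 0) :
    P.ord (f * g) = P.ord f + P.ord g := by
  obtain ⟨t, ht, -, -⟩ := hP.exists_uniformizer
  refine hP.ord_eq (mul_ne_zero hf hg) (ht.isOrd_iff.2 ?_)
  rw [map_mul, ht.isOrd_iff.1 (hP.isOrd_ord hf), ht.isOrd_iff.1 (hP.isOrd_ord hg),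
    zpow_add₀ ht.valuation_pos.ne']

theorem ord_eq_one (hP : P.IsCoordinate z δ) {t : K} (ht : P.IsUniformizer t) : P.ord t = 1 :=
  hP.ord_eq ht.1 (ht.isOrd_iff.2 (zpow_one _).symm)

theorem ord_eq_zero (hP : P.IsCoordinate z δ) {f : K} (hf : P.ring.valuation f = 1) :
    P.ord f = 0 := by
  obtain ⟨t, ht, -, -⟩ := hP.exists_uniformizer
  exact hP.ord_eq (by rintro rfl; simp at hf) (ht.isOrd_iff.2 (by simpa using hf))

theorem ord_div (hP : P.IsCoordinate z δ) {f g : K} (hf : f ≠ 0) (hg : g ≠ 0) :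
    P.ord (f / g) = P.ord f - P.ord g := by
  have h := hP.ord_mul (div_ne_zero hf hg) hg
  rw [div_mul_cancel₀ f hg] at h
  omega

theorem ord_pow (hP : P.IsCoordinate z δ) {f : K} (hf : f ≠ 0) (n : ℕ) :
    P.ord (f ^ n) = n * P.ord f := by
  induction n with
  | zero => simpa using hP.ord_eq_zero (f := 1) (by simp)
  | succ n ih =>
    rw [pow_succ, hP.ord_mul (pow_ne_zero n hf) hf, ih]
    push_cast
    ring

theorem mem_ring_iff_ord (hP : P.IsCoordinate z δ) {f : K} (hf : f ≠ 0) :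
    f ∈ P.ring ↔ 0 ≤ P.ord f := by
  obtain ⟨t, ht, -, -⟩ := hP.exists_uniformizer
  rw [mem_ring_iff, ht.isOrd_iff.1 (hP.isOrd_ord hf), ← ht.zpow_le_zpow_iff, zpow_zero]

theorem ordDiff_smul_D (hP : P.IsCoordinate z δ) {h : K} (hh : h ≠ 0) :
    P.ordDiff (h • KaehlerDifferential.D k K z) = P.ord h := by
  obtain ⟨t, ht, -, -⟩ := hP.exists_uniformizer
  have hδ : ∀ s, P.IsUniformizer s → δ s ≠ 0 := fun s hs h0 => by
    simpa [h0] using hP.valuation_apply_uniformizer hs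
  have hex : ∃ n, ∃ t' h' : K, P.IsUniformizer t' ∧ h • KaehlerDifferential.D k K z =
      h' • KaehlerDifferential.D k K t' ∧ P.IsOrd h' n := by
    refine ⟨P.ord (h / δ t), t, h / δ t, ht, ?_, hP.isOrd_ord (div_ne_zero hh (hδ t ht))⟩
    rw [hP.D_eq t, smul_smul, div_mul_cancel₀ h (hδ t ht)]
  -- The parameter `s` behind the chosen order is unknown, but `h = h' δ s` and `δ s` is a unit.
  obtain ⟨s, h', hs, e, ho⟩ := Classical.epsilon_spec hex
  rw [hP.D_eq s, smul_smul] at e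
  refine ht.isOrd_unique ?_ (hP.isOrd_ord hh)
  change P.IsOrd h' (P.ordDiff _) at ho
  rw [ht.isOrd_iff] at ho ⊢
  conv_lhs => rw [hP.smul_D_injective e, map_mul, hP.valuation_apply_uniformizer hs, mul_one]
  exact ho

theorem ordDiff_smul (hP : P.IsCoordinate z δ) {f : K} {ω : KaehlerDifferential k K} (hf : f ≠ 0)
    (hω : ω ≠ 0) : P.ordDiff (f • ω) = P.ord f + P.ordDiff ω := by
  obtain ⟨h, rfl⟩ := hP.exists_eq_smul_D ω
  have hh : h ≠ 0 := by rintro rfl; simp at hω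
  rw [smul_smul, hP.ordDiff_smul_D hh, hP.ordDiff_smul_D (mul_ne_zero hf hh), hP.ord_mul hf hh]

/-- The residue of a differential with at most a simple pole does not depend on the local
parameter. -/
theorem residue_eq (hP : P.IsCoordinate z δ) {t h : K} {p : k[X]} (ht : P.IsUniformizer t)
    (hp : h - aeval t⁻¹ p ∈ P.ring) (hth : t * h ∈ P.ring) :
    P.residue (h • KaehlerDifferential.D k K t) = p.coeff 1 := by
  have hex : ∃ c, P.IsResidue (h • KaehlerDifferential.D k K t) c := ⟨_, t, h, p, ht, rfl, hp, rfl⟩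
  obtain ⟨s, h', p', hs, e, hp', hc⟩ := Classical.epsilon_spec hex
  change P.residue _ = _ at hc
  rw [hc]
  rw [hP.D_eq t, hP.D_eq s, smul_smul, smul_smul] at e
  have e' := hP.smul_D_injective e
  have hvs := hP.valuation_apply_uniformizer hs
  have hδs : δ s ≠ 0 := fun h0 => by simp [h0] at hvs
  have hw : P.ring.valuation (t / s) = 1 := by
    rw [map_div₀, ht.valuation_eq hs, div_self hs.valuation_pos.ne']
  have hs0 := hs.1
  have ht0 := ht.1
  have hδt : δ t = (t / s) * δ s + s * δ (t / s) := by
    conv_lhs => rw [← div_mul_cancel₀ t hs.1, Derivation.leibniz, smul_eq_mul, smul_eq_mul]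
  -- With `w = t / s`, the relation `h' δ s = h δ t` and `δ t = w δ s + s δ w` show that `s h'` and
  -- `t h` differ by a multiple of `s`; hence they take the same value at `P`, which is the residue.
  have hdiff : s * h' - t * h = (t * h) * (s * (δ (t / s) / ((t / s) * δ s))) := by
    have : h' = h * δ t / δ s := by rw [e']; field_simp
    rw [this, hδt]
    field_simp
    ring
  have hmem : s * h' - t * h ∈ P.ring.nonunits := by
    have hv : P.ring.valuation (δ (t / s) / (t / s * δ s)) = P.ring.valuation (δ (t / s)) := by
      rw [map_div₀ P.ring.valuation, map_mul, hw, hvs, one_mul, div_one]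
    rw [hdiff, mem_nonunits_iff, Valuation.map_mul _ (t * h), Valuation.map_mul _ s, hv]
    rw [mul_comm]
    exact mul_lt_one_of_lt_of_le (mul_lt_one_of_lt_of_le hs.valuation_lt_one
      (mem_ring_iff.1 (hP.map_mem _ (mem_ring_iff.2 hw.le)))) (mem_ring_iff.1 hth)
  have hsh : s * h' ∈ P.ring := by
    rw [← sub_add_cancel (s * h') (t * h)]
    exact add_mem (P.ring.nonunits_subset hmem) hth
  have h1 := ht.mul_sub_coeff_one_mem hp hth
  have h2 := hs.mul_sub_coeff_one_mem hp' hsh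
  rw [← sub_eq_zero, ← algebraMap_mem_nonunits_iff (P := P) (K := K), map_sub]
  rw [mem_nonunits_iff] at *
  have : algebraMap k K (p'.coeff 1) - algebraMap k K (p.coeff 1) =
      (t * h - algebraMap k K (p.coeff 1)) - (s * h' - algebraMap k K (p'.coeff 1)) +
        (s * h' - t * h) := by ring
  rw [this]
  exact Valuation.map_add_lt _ (Valuation.map_sub_lt _ h1 h2) hmem

end IsCoordinate

end Place

/-! ### Derivations of the function field, charts and their places -/

namespace Hermitian

variable {q : ℕ} {F : Type*} [Field F]

theorem adjoin_root_of_X :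
    Algebra.adjoin F {AdjoinRoot.root (poly q F), AdjoinRoot.of (poly q F) X} = ⊤ := by
  set S := Algebra.adjoin F {AdjoinRoot.root (poly q F), AdjoinRoot.of (poly q F) X}
  have hx : AdjoinRoot.root (poly q F) ∈ S := Algebra.subset_adjoin (Set.mem_insert _ _)
  have hy : AdjoinRoot.of (poly q F) X ∈ S :=
    Algebra.subset_adjoin (Set.mem_insert_of_mem _ rfl)
  have hof : ∀ p : F[X], AdjoinRoot.of (poly q F) p ∈ S := by
    intro p
    induction p using Polynomial.induction_on' with
    | add p r hp hr => rw [map_add]; exact add_mem hp hr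
    | monomial n c =>
      rw [← C_mul_X_pow_eq_monomial, map_mul, map_pow]
      exact mul_mem (S.algebraMap_mem c) (pow_mem hy n)
  refine eq_top_iff.2 fun g _ => ?_
  obtain ⟨P, rfl⟩ := AdjoinRoot.mk_surjective g
  induction P using Polynomial.induction_on' with
  | add p r hp hr => rw [map_add]; exact add_mem (hp trivial) (hr trivial)
  | monomial n c =>
    rw [← C_mul_X_pow_eq_monomial, map_mul, map_pow, AdjoinRoot.mk_C, AdjoinRoot.mk_X]
    exact mul_mem (hof c) (pow_mem hx n)

theorem root_equation : AdjoinRoot.root (poly q F) ^ (q + 1) =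
    AdjoinRoot.of (poly q F) X ^ q + AdjoinRoot.of (poly q F) X := by
  have h : AdjoinRoot.mk (poly q F) (X ^ (q + 1) - C (X ^ q + X)) = 0 := AdjoinRoot.mk_self
  rwa [map_sub, sub_eq_zero, map_pow, AdjoinRoot.mk_X, AdjoinRoot.mk_C, map_add, map_pow] at h

theorem evalAt_root (S : AffinePoint q F) : evalAt S (AdjoinRoot.root _) = S.1.1 := by
  simp [evalAt]

theorem evalAt_of_X (S : AffinePoint q F) : evalAt S (AdjoinRoot.of _ X) = S.1.2 := by
  simp [evalAt]

section

variable [Fintype F] [hq : Fact (Fintype.card F = q ^ 2)]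

/-- The differential of `x ^ (q + 1) = y ^ q + y` is `x ^ q dx = dy`. -/
theorem derivation_apply_of_equation {K M : Type*} [Field K] [Algebra F K] [AddCommGroup M]
    [Module F M] [Module K M] (d : Derivation F K M) {x y : K}
    (h : x ^ (q + 1) = y ^ q + y) : d y = x ^ q • d x := by
  have hqK : (q : K) = 0 := by rw [← map_natCast (algebraMap F K), q_cast hq.out, map_zero]
  have h1 := congrArg d h
  rw [Derivation.leibniz_pow, map_add, Derivation.leibniz_pow, ← Nat.cast_smul_eq_nsmul K,
    ← Nat.cast_smul_eq_nsmul K, hqK] at h1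
  push_cast at h1
  simpa [hqK] using h1.symm

variable (ψ : CoordinateRing q F →ₐ[F] FunctionField q F)

theorem chart_equation : ψ (AdjoinRoot.root _) ^ (q + 1) =
    ψ (AdjoinRoot.of _ X) ^ q + ψ (AdjoinRoot.of _ X) := by
  rw [← map_pow, root_equation, map_add, map_pow]

/-- The equation determines the derivative of the second coordinate from that of the first, and the
two coordinates generate the field. -/
theorem derivation_ext_of_chart (hψ' : ∀ f, ∃ g h, f = ψ g / ψ h) {M : Type*} [AddCommGroup M]
    [Module F M] [Module (FunctionField q F) M]
    {d₁ d₂ : Derivation F (FunctionField q F) M}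
    (h : d₁ (ψ (AdjoinRoot.root _)) = d₂ (ψ (AdjoinRoot.root _))) : d₁ = d₂ := by
  have hA : ∀ g, d₁ (ψ g) = d₂ (ψ g) := by
    intro g
    have hg : g ∈ Algebra.adjoin F
        {AdjoinRoot.root (poly q F), AdjoinRoot.of (poly q F) X} :=
      adjoin_root_of_X (q := q) (F := F) ▸ Algebra.mem_top
    induction hg using Algebra.adjoin_induction with
    | mem z hz =>
      rcases hz with rfl | rfl
      · exact h
      · rw [derivation_apply_of_equation d₁ (chart_equation ψ),
          derivation_apply_of_equation d₂ (chart_equation ψ), h]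
    | algebraMap c => simp
    | add a b _ _ ha hb => simp [ha, hb]
    | mul a b _ _ ha hb => simp [ha, hb]
  ext f
  obtain ⟨g, h, rfl⟩ := hψ' f
  rw [Derivation.leibniz_div, Derivation.leibniz_div, hA, hA]

theorem algHom_surjective (f : FunctionField q F) : ∃ g h,
    f = Algebra.algHom F (CoordinateRing q F) (FunctionField q F) g /
      Algebra.algHom F (CoordinateRing q F) (FunctionField q F) h := by
  obtain ⟨g, h, -, e⟩ := IsFractionRing.div_surjective (CoordinateRing q F) f
  exact ⟨g, h, e.symm⟩

theorem algHom_injective :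
    Function.Injective (Algebra.algHom F (CoordinateRing q F) (FunctionField q F)) :=
  IsFractionRing.injective _ _

variable (q F) in
/-- The homomorphism `f ↦ f + (df / dx) ε` on the affine coordinate ring. -/
noncomputable def tangentHom : CoordinateRing q F →ₐ[F] DualNumber (FunctionField q F) :=
  AdjoinRoot.liftAlgHom (poly q F)
    (aeval (TrivSqZeroExt.inl (y q F) + TrivSqZeroExt.inr (x q F ^ q)))
    (TrivSqZeroExt.inl (x q F) + TrivSqZeroExt.inr 1) (by
      -- Since `q = 0`, both `(x + ε) ^ (q + 1)` and `(y + x ^ q ε) ^ q + (y + x ^ q ε)` have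
      -- `ε`-part `x ^ q`.
      have hqK : (q : FunctionField q F) = 0 := by
        rw [← map_natCast (algebraMap F (FunctionField q F)), q_cast hq.out, map_zero]
      change eval₂ _ _ (X ^ (q + 1) - C (X ^ q + X)) = 0
      rw [eval₂_sub, eval₂_X_pow, eval₂_C]
      ext
      · simp [equation]
      · simp [hqK])

theorem fst_tangentHom (g : CoordinateRing q F) :
    (tangentHom q F g).fst = algebraMap _ (FunctionField q F) g := by
  have : (TrivSqZeroExt.fstHom F (FunctionField q F) (FunctionField q F)).comp (tangentHom q F) =
      Algebra.algHom F (CoordinateRing q F) (FunctionField q F) := by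
    refine AlgHom.ext_of_adjoin_eq_top adjoin_root_of_X ?_
    rintro z (rfl | rfl)
    · simp [tangentHom, x]; rfl
    · simp [tangentHom, y]; rfl
  exact DFunLike.congr_fun this g

variable (q F) in
/-- The homomorphism `f ↦ f + (df / dx) ε` on the function field. -/
noncomputable def tangentHomField : FunctionField q F →ₐ[F] DualNumber (FunctionField q F) :=
  IsLocalization.liftAlgHom (M := nonZeroDivisors (CoordinateRing q F)) (f := tangentHom q F)
    fun g => by
      rw [TrivSqZeroExt.isUnit_iff_isUnit_fst, fst_tangentHom, isUnit_iff_ne_zero]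
      exact IsFractionRing.to_map_ne_zero_of_mem_nonZeroDivisors g.2

theorem tangentHomField_algebraMap (g : CoordinateRing q F) :
    tangentHomField q F (algebraMap _ _ g) = tangentHom q F g :=
  IsLocalization.lift_eq _ g

theorem fst_tangentHomField (f : FunctionField q F) : (tangentHomField q F f).fst = f := by
  have : (TrivSqZeroExt.fstHom F (FunctionField q F) (FunctionField q F)).comp
      (tangentHomField q F) = AlgHom.id F _ := by
    refine AlgHom.coe_ringHom_injective
      (IsLocalization.ringHom_ext (nonZeroDivisors (CoordinateRing q F)) ?_)
    refine RingHom.ext fun g => ?_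
    exact (congrArg TrivSqZeroExt.fst (tangentHomField_algebraMap g)).trans (fst_tangentHom g)
  exact DFunLike.congr_fun this f

variable (q F) in
/-- The derivation `d / dx` of the function field. -/
noncomputable def derivationX : Derivation F (FunctionField q F) (FunctionField q F) :=
  Derivation.mk' ((TrivSqZeroExt.sndHom (FunctionField q F) (FunctionField q F)).restrictScalars F
    ∘ₗ (tangentHomField q F).toLinearMap) fun a b => by
      simp [fst_tangentHomField, mul_comm]

theorem derivationX_x : derivationX q F (x q F) = 1 := by
  change (tangentHomField q F (algebraMap _ _ _)).snd = 1
  rw [tangentHomField_algebraMap]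
  simp [tangentHom]

/-- For the first coordinate `z` of a chart, `d / dz` is `d / dx` divided by `dz / dx`, which is
nonzero because otherwise `d / dx` would vanish by uniqueness. It preserves the chart ring, since
the second coordinate has derivative `z ^ q`. -/
theorem exists_derivation_of_chart (hψ' : ∀ f, ∃ g h, f = ψ g / ψ h) :
    ∃ δ : Derivation F (FunctionField q F) (FunctionField q F),
      δ (ψ (AdjoinRoot.root _)) = 1 ∧
      (∀ f, KaehlerDifferential.D F (FunctionField q F) f =
        δ f • KaehlerDifferential.D F _ (ψ (AdjoinRoot.root _))) ∧
      ∀ g, ∃ g', δ (ψ g) = ψ g' := by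
  set z := ψ (AdjoinRoot.root _)
  have h0 : derivationX q F z ≠ 0 := by
    intro h
    have h1 : derivationX q F = 0 := derivation_ext_of_chart ψ hψ' h
    simpa [h1] using derivationX_x (q := q) (F := F)
  let δ := (derivationX q F z)⁻¹ • derivationX q F
  have hδ : δ z = 1 := by simp [δ, h0]
  refine ⟨δ, hδ, fun f => ?_, fun g => ?_⟩
  · have : KaehlerDifferential.D F (FunctionField q F) =
        (LinearMap.toSpanSingleton (FunctionField q F) _
          (KaehlerDifferential.D F (FunctionField q F) z)).compDer δ :=
      derivation_ext_of_chart ψ hψ' (by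
        change _ = δ z • KaehlerDifferential.D F (FunctionField q F) z
        rw [hδ, one_smul])
    conv_lhs => rw [this]
    rfl
  · have hg : g ∈ Algebra.adjoin F
        {AdjoinRoot.root (poly q F), AdjoinRoot.of (poly q F) X} :=
      adjoin_root_of_X (q := q) (F := F) ▸ Algebra.mem_top
    induction hg using Algebra.adjoin_induction with
    | mem w hw =>
      rcases hw with rfl | rfl
      · exact ⟨1, by rw [hδ, map_one]⟩
      · refine ⟨AdjoinRoot.root _ ^ q, ?_⟩
        rw [derivation_apply_of_equation δ (chart_equation ψ), hδ, map_pow, smul_eq_mul, mul_one]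
    | algebraMap c => exact ⟨0, by simp⟩
    | add a b _ _ ha hb =>
      obtain ⟨a', ha'⟩ := ha
      obtain ⟨b', hb'⟩ := hb
      exact ⟨a' + b', by simp [ha', hb']⟩
    | mul a b _ _ ha hb =>
      obtain ⟨a', ha'⟩ := ha
      obtain ⟨b', hb'⟩ := hb
      exact ⟨a * b' + b * a', by simp [ha', hb']⟩

/-- A place whose valuation ring contains an affine chart of the curve has the first coordinate
of the chart as a coordinate. -/
theorem exists_isCoordinate_of_chart
    (hψ' : ∀ f, ∃ g h, f = ψ g / ψ h) (P : Place F (FunctionField q F))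
    (hP : ∀ g, ψ g ∈ P.ring) :
    ∃ δ, P.IsCoordinate (ψ (AdjoinRoot.root _)) δ := by
  obtain ⟨δ, hδ, hD, hδψ⟩ := exists_derivation_of_chart ψ hψ'
  let φ : CoordinateRing q F →+* P.ring := ψ.toRingHom.codRestrict P.ring.toSubring hP
  let p := (IsLocalRing.maximalIdeal P.ring).comap φ
  have hp : p.IsPrime := Ideal.comap_isPrime _ _
  have hmem : ∀ g, g ∈ p ↔ ψ g ∈ P.ring.nonunits := fun g =>
    (ValuationSubring.coe_mem_nonunits_iff (a := φ g)).symm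
  have hv : ∀ g, g ∉ p → P.ring.valuation (ψ g) = 1 := fun g hg =>
    le_antisymm (Place.mem_ring_iff.1 (hP g)) (not_lt.1 fun h =>
      hg ((hmem g).2 (Place.mem_nonunits_iff.2 h)))
  have hψ0 : ∀ g, g ∉ p → ψ g ≠ 0 := fun g hg h => by simpa [h] using hv g hg
  -- If the centre were zero, every nonzero element of the chart ring would be a unit at `P`, and
  -- `P.ring` would be the whole field.
  have hp0 : p ≠ ⊥ := by
    intro h0
    refine P.ne_top (eq_top_iff.2 fun f _ => ?_)
    obtain ⟨g, h, rfl⟩ := hψ' f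
    by_cases hh : h ∈ p
    · rw [h0, Ideal.mem_bot] at hh
      simp [hh]
    · rw [Place.mem_ring_iff, map_div₀, hv h hh, div_one, ← Place.mem_ring_iff]
      exact hP g
  obtain ⟨π, hπ, hdπ, hfac⟩ := exists_separable_local_parameter (k := F) (q_cast hq.out)
    root_equation adjoin_root_of_X p hp0
  set t := aeval (AdjoinRoot.root (poly q F)) π
  have hδt : δ (ψ t) = ψ (aeval (AdjoinRoot.root (poly q F)) (derivative π)) := by
    rw [← aeval_algHom_apply, Derivation.map_aeval, hδ, smul_eq_mul, mul_one, aeval_algHom_apply]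
  have ht0 : ψ t ≠ 0 := by
    intro h
    rw [h, map_zero] at hδt
    refine hdπ ((hmem _).2 ?_)
    rw [← hδt, Place.mem_nonunits_iff]
    simp
  have htlt : P.ring.valuation (ψ t) < 1 := Place.mem_nonunits_iff.1 ((hmem t).1 hπ)
  have htpos : 0 < P.ring.valuation (ψ t) := zero_lt_iff.2 ((Valuation.ne_zero_iff _).2 ht0)
  -- Elements outside the centre `p` are units at `P`, so this factorization shows that the
  -- valuation is discrete with parameter `ψ t`.
  have key : ∀ f : FunctionField q F, f ≠ 0 → ∃ (n : ℤ) (a b : CoordinateRing q F),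
      a ∉ p ∧ b ∉ p ∧ f = ψ a / ψ b * ψ t ^ n := by
    intro f hf
    obtain ⟨g, h, rfl⟩ := hψ' f
    obtain ⟨n, s, s', hs, hs', e⟩ := hfac g (by rintro rfl; simp at hf)
    obtain ⟨m, r, r', hr, hr', e'⟩ := hfac h (by rintro rfl; simp at hf)
    refine ⟨n - m, s' * r, s * r', hp.mul_notMem hs' hr, hp.mul_notMem hs hr', ?_⟩
    have h1 := congrArg ψ e
    have h2 := congrArg ψ e'
    rw [map_mul, map_mul, map_pow] at h1 h2
    have := hψ0 s hs
    have := hψ0 s' hs'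
    have := hψ0 r hr
    have := hψ0 r' hr'
    have hh : ψ h ≠ 0 := by rintro h0; simp [h0] at hf
    rw [map_mul, map_mul, zpow_sub₀ ht0, zpow_natCast, zpow_natCast]
    field_simp
    linear_combination (ψ r' * ψ t ^ m) * h1 - (ψ s' * ψ t ^ n) * h2
  have hval : ∀ (n : ℤ) (a b : CoordinateRing q F), a ∉ p → b ∉ p →
      P.ring.valuation (ψ a / ψ b * ψ t ^ n) = P.ring.valuation (ψ t) ^ n := by
    intro n a b ha hb
    rw [map_mul, map_div₀, map_zpow₀, hv a ha, hv b hb, div_one, one_mul]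
  have hle : ∀ m n : ℤ, P.ring.valuation (ψ t) ^ m ≤ P.ring.valuation (ψ t) ^ n ↔ n ≤ m :=
    fun m n => zpow_le_zpow_iff_right_of_lt_one₀ htpos htlt
  refine ⟨δ, hD, hδ, fun f hf => ?_, ψ t, ⟨ht0, fun f => ?_⟩, ?_, fun f hf => ?_⟩
  · by_cases hf0 : f = 0
    · rw [hf0, map_zero]
      exact zero_mem _
    obtain ⟨n, a, b, ha, hb, rfl⟩ := key f hf0
    rw [Place.mem_ring_iff, hval n a b ha hb, ← zpow_zero (P.ring.valuation (ψ t)), hle] at hf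
    -- A regular function is thus a quotient of chart functions whose denominator is a unit at `P`,
    -- and the quotient rule introduces no other denominators.
    lift n to ℕ using hf
    obtain ⟨c, hc⟩ := hδψ (a * t ^ n)
    obtain ⟨d, hd⟩ := hδψ b
    rw [zpow_natCast, div_mul_eq_mul_div, ← map_pow, ← map_mul, Derivation.leibniz_div, hc, hd]
    have hbinv : (ψ b)⁻¹ ∈ P.ring := by
      rw [Place.mem_ring_iff, map_inv₀, hv b hb, inv_one]
    simp only [smul_eq_mul]
    exact mul_mem (pow_mem hbinv 2) (sub_mem (mul_mem (hP _) (hP _)) (mul_mem (hP _) (hP _)))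
  · by_cases hf0 : f = 0
    · simp [hf0, zero_mem]
    obtain ⟨n, a, b, ha, hb, rfl⟩ := key f hf0
    rw [Place.mem_nonunits_iff, Place.mem_ring_iff, map_div₀, hval n a b ha hb,
      div_le_one₀ htpos, ← not_le, ← zpow_zero (P.ring.valuation (ψ t)), hle]
    have h1 := hle n 1
    rw [zpow_one] at h1
    rw [h1]
    omega
  · rw [hδt, ← hmem]
    exact hdπ
  · obtain ⟨n, a, b, ha, hb, rfl⟩ := key f hf
    exact ⟨n, hval n a b ha hb⟩

/-- A place at which the coordinates of a chart take the values of the coordinates of a point is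
the place at this point. -/
theorem eq_placeOf (hψ : Function.Injective ψ) (hψ' : ∀ f, ∃ g h, f = ψ g / ψ h)
    (S : AffinePoint q F) (P : Place F (FunctionField q F))
    (hx : ψ (AdjoinRoot.root _) - algebraMap F _ S.1.1 ∈ P.ring.nonunits)
    (hy : ψ (AdjoinRoot.of _ X) - algebraMap F _ S.1.2 ∈ P.ring.nonunits) :
    P = placeOf ψ hψ hψ' S := by
  have hmem : ∀ g, ψ g - algebraMap F _ (evalAt S g) ∈ P.ring.nonunits := by
    intro g
    have hg : g ∈ Algebra.adjoin F
        {AdjoinRoot.root (poly q F), AdjoinRoot.of (poly q F) X} :=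
      adjoin_root_of_X (q := q) (F := F) ▸ Algebra.mem_top
    induction hg using Algebra.adjoin_induction with
    | mem w hw =>
      rcases hw with rfl | rfl
      · rwa [evalAt_root]
      · rwa [evalAt_of_X]
    | algebraMap c =>
      rw [AlgHom.commutes, AlgHom.commutes, Algebra.algebraMap_self_apply, sub_self,
        Place.mem_nonunits_iff, map_zero]
      exact zero_lt_one
    | add a b _ _ ha hb =>
      rw [map_add, map_add, map_add, add_sub_add_comm]
      rw [Place.mem_nonunits_iff] at *
      exact Valuation.map_add_lt _ ha hb
    | mul a b _ _ ha hb =>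
      have hbO : ψ b ∈ P.ring := by
        rw [← sub_add_cancel (ψ b) (algebraMap F _ (evalAt S b))]
        exact add_mem (P.ring.nonunits_subset hb) (P.algebraMap_mem _)
      rw [map_mul, map_mul, map_mul]
      have : ψ a * ψ b - algebraMap F (FunctionField q F) (evalAt S a) *
          algebraMap F _ (evalAt S b) = (ψ a - algebraMap F _ (evalAt S a)) * ψ b +
          (ψ b - algebraMap F _ (evalAt S b)) * algebraMap F _ (evalAt S a) := by ring
      rw [this]
      rw [Place.mem_nonunits_iff] at *
      refine Valuation.map_add_lt _ ?_ ?_ <;> rw [map_mul]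
      · exact mul_lt_one_of_lt_of_le ha (Place.mem_ring_iff.1 hbO)
      · exact mul_lt_one_of_lt_of_le hb (Place.mem_ring_iff.1 (P.algebraMap_mem _))
  have hO : ∀ g, ψ g ∈ P.ring := fun g => by
    rw [← sub_add_cancel (ψ g) (algebraMap F _ (evalAt S g))]
    exact add_mem (P.ring.nonunits_subset (hmem g)) (P.algebraMap_mem _)
  have hunit : ∀ h, evalAt S h ≠ 0 → P.ring.valuation (ψ h) = 1 := by
    intro h hh
    refine le_antisymm (Place.mem_ring_iff.1 (hO h)) (not_lt.1 fun hlt => hh ?_)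
    rw [← Place.algebraMap_mem_nonunits_iff (P := P) (K := FunctionField q F),
      Place.mem_nonunits_iff, ← sub_sub_cancel (ψ h) (algebraMap F _ (evalAt S h))]
    exact Valuation.map_sub_lt _ hlt (Place.mem_nonunits_iff.1 (hmem h))
  refine Place.ext_ring (ValuationSubring.ext _ _ fun f => ⟨fun hf => ?_, ?_⟩)
  · rcases (placeOf ψ hψ hψ' S).ring.mem_or_inv_mem f with h | ⟨g, h, hh, e⟩
    · exact h
    · by_cases hg : evalAt S g = 0
      · have h1 : P.ring.valuation f⁻¹ < 1 := by
          rw [e, map_div₀, hunit h hh, div_one, ← Place.mem_nonunits_iff]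
          simpa [hg] using hmem g
        have h2 := Place.mem_ring_iff.1 hf
        by_cases hf0 : f = 0
        · rw [hf0]
          exact zero_mem _
        · have h3 : P.ring.valuation f⁻¹ * P.ring.valuation f = 1 := by
            rw [← map_mul, inv_mul_cancel₀ hf0, map_one]
          exact absurd (mul_lt_one_of_lt_of_le h1 h2) h3.not_lt
      · exact ⟨h, g, hg, by rw [← inv_inv f, e, inv_div]⟩
  · rintro ⟨g, h, hh, rfl⟩
    rw [Place.mem_ring_iff, map_div₀, hunit h hh, div_one, ← Place.mem_ring_iff]
    exact hO g

theorem mem_placeOf (hψ : Function.Injective ψ) (hψ' : ∀ f, ∃ g h, f = ψ g / ψ h)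
    (S : AffinePoint q F) (g : CoordinateRing q F) : ψ g ∈ (placeOf ψ hψ hψ' S).ring :=
  ⟨g, 1, by simp, by simp⟩

theorem mem_nonunits_placeOf (hψ : Function.Injective ψ) (hψ' : ∀ f, ∃ g h, f = ψ g / ψ h)
    (S : AffinePoint q F) {g : CoordinateRing q F} (hg : evalAt S g = 0) :
    ψ g ∈ (placeOf ψ hψ hψ' S).ring.nonunits := by
  rw [ValuationSubring.mem_nonunits_iff_or, or_iff_not_imp_left]
  rintro h0 ⟨a, b, hb, e⟩
  have hψb : ψ b ≠ 0 := (map_ne_zero_iff ψ hψ).2 (by rintro rfl; simp at hb)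
  have : ψ b = ψ (a * g) := by
    rw [map_mul]
    field_simp at e
    linear_combination e
  rw [hψ this, map_mul, hg, mul_zero] at hb
  exact hb rfl

/-- The residue field at a rational point is `F`, which gives `eval` its meaning there. -/
theorem exists_sub_mem_nonunits_placeOf (hψ : Function.Injective ψ)
    (hψ' : ∀ f, ∃ g h, f = ψ g / ψ h) (S : AffinePoint q F) {f : FunctionField q F}
    (hf : f ∈ (placeOf ψ hψ hψ' S).ring) :
    ∃ c : F, f - algebraMap F _ c ∈ (placeOf ψ hψ hψ' S).ring.nonunits := by
  obtain ⟨g, h, hh, rfl⟩ := hf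
  have hψh : ψ h ≠ 0 := (map_ne_zero_iff ψ hψ).2 (by rintro rfl; simp at hh)
  refine ⟨evalAt S g / evalAt S h, ?_⟩
  have h1 := mem_nonunits_placeOf ψ hψ hψ' S
    (g := g - algebraMap F _ (evalAt S g / evalAt S h) * h) (by simp [hh])
  have h2 : (ψ h)⁻¹ ∈ (placeOf ψ hψ hψ' S).ring := ⟨1, h, hh, by simp⟩
  have : ψ g / ψ h - algebraMap F _ (evalAt S g / evalAt S h) =
      ψ (g - algebraMap F _ (evalAt S g / evalAt S h) * h) * (ψ h)⁻¹ := by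
    rw [map_sub, map_mul, AlgHom.commutes]
    field_simp
  rw [this]
  rw [Place.mem_nonunits_iff] at *
  rw [map_mul]
  exact mul_lt_one_of_lt_of_le h1 (Place.mem_ring_iff.1 h2)

end

end Hermitian

namespace Place

variable {k K : Type*} [Field k] [Field K] [Algebra k K] {P : Place k K}

theorem ord_congr {f g : K} (h : P.ring.valuation f = P.ring.valuation g) : P.ord f = P.ord g := by
  simp only [ord, IsOrd, h]

theorem sub_mem_nonunits_iff {f g : K} (hf : f ∈ P.ring) (hg : g ∈ P.ring) :
    f - g ∈ P.ring.nonunits ↔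
      IsLocalRing.residue P.ring ⟨f, hf⟩ = IsLocalRing.residue P.ring ⟨g, hg⟩ := by
  rw [← sub_eq_zero, ← map_sub, IsLocalRing.residue_eq_zero_iff,
    ← ValuationSubring.coe_mem_nonunits_iff]
  rfl

end Place

/-! ### Frobenius identities: `R = x ^ (q ^ 2) - x` and `u = -1` -/

namespace Hermitian

variable {q : ℕ} {F : Type*} [Field F] [Fintype F] [hq : Fact (Fintype.card F = q ^ 2)]

variable (q F) in
theorem exists_eq_char_pow : ∃ p n : ℕ, p.Prime ∧ CharP F p ∧ q = p ^ n := by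
  obtain ⟨p, hp⟩ := CharP.exists F
  obtain ⟨n, hpr, hn⟩ := FiniteField.card F p
  rw [hq.out] at hn
  obtain ⟨m, -, hm⟩ := (Nat.dvd_prime_pow hpr).1 (hn ▸ dvd_pow_self q two_ne_zero)
  exact ⟨p, m, hpr, hp, hm⟩

variable (F) in
theorem add_pow_q {A : Type*} [CommRing A] [Nontrivial A] [Algebra F A] (a b : A) :
    (a + b) ^ q = a ^ q + b ^ q := by
  obtain ⟨p, n, hp, hc, rfl⟩ := exists_eq_char_pow q F
  have := Fact.mk hp
  have : CharP A p := charP_of_injective_algebraMap (algebraMap F A).injective p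
  exact add_pow_char_pow ..

theorem prod_X_sub_C_univ : ∏ c : F, (X - C c) = (X ^ q ^ 2 - X : F[X]) := by
  have hdeg := FiniteField.X_pow_card_sub_X_natDegree_eq F (Fintype.one_lt_card (α := F))
  have hroots := FiniteField.roots_X_pow_card_sub_X F
  have hmon : (X ^ Fintype.card F - X : F[X]).Monic :=
    monic_X_pow_sub (by rw [degree_X]; exact_mod_cast Fintype.one_lt_card)
  have h := prod_multiset_X_sub_C_of_monic_of_roots_card_eq hmon (by rw [hroots, hdeg]; rfl)
  rw [hroots, hq.out] at h
  exact h

/-- The monic polynomial whose roots are the elements `c` of `F` with `c ^ q + c ≠ 0` is the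
cofactor of `X ^ q + X` in `X ^ (q ^ 2) - X`. -/
theorem mul_prod_traceNonzero :
    (X ^ q + X) * ∏ c ∈ traceNonzero q F, (X - C c) = (X ^ q ^ 2 - X : F[X]) := by
  classical
  have hq2 := two_le_q hq.out
  rw [← prod_X_sub_C_univ, ← Finset.prod_filter_mul_prod_filter_not Finset.univ
    (fun c : F => c ^ q + c = 0)]
  have ht : traceNonzero q F = Finset.univ.filter fun c => ¬ (c ^ q + c = 0) := by
    ext; simp [traceNonzero]
  rw [ht]
  congr 1
  have hmon : (X ^ q + X : F[X]).Monic := monic_X_pow_add (by rw [degree_X]; exact_mod_cast hq2)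
  refine eq_of_monic_of_associated hmon (monic_prod_X_sub_C _ _)
    (associated_of_dvd_dvd ?_ ?_)
  -- The quotient comes from `X ^ (q ^ 2) - X = (X ^ q + X) ^ q - (X ^ q + X)`. Being coprime to
  -- each `X - c` with `c ^ q + c ≠ 0`, the polynomial `X ^ q + X` divides the product of the other
  -- linear factors.
  · have hd : (X ^ q + X : F[X]) ∣ X ^ q ^ 2 - X := by
      have : (X ^ q ^ 2 - X : F[X]) = (X ^ q + X) ^ q - (X ^ q + X) := by
        rw [add_pow_q F, ← pow_mul, sq]
        ring
      rw [this]
      exact dvd_sub (dvd_pow_self _ (by omega)) dvd_rfl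
    rw [← prod_X_sub_C_univ, ← Finset.prod_filter_mul_prod_filter_not Finset.univ
      (fun c : F => c ^ q + c = 0)] at hd
    refine IsCoprime.dvd_of_dvd_mul_right (IsCoprime.prod_right fun c hc => ?_) hd
    refine IsCoprime.symm ((irreducible_X_sub_C c).coprime_iff_not_dvd.2 fun h => ?_)
    rw [dvd_iff_isRoot, IsRoot.def, eval_add, eval_pow, eval_X] at h
    exact (Finset.mem_filter.1 hc).2 h
  · refine Finset.prod_dvd_of_coprime (fun c _ d _ hcd => ?_) fun c hc => ?_
    · exact pairwise_coprime_X_sub_C Function.injective_id hcd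
    · rw [dvd_iff_isRoot, IsRoot.def, eval_add, eval_pow, eval_X]
      exact (Finset.mem_filter.1 hc).2

/-- Let `Π` be the product in `mul_prod_traceNonzero`. Differentiating that identity and evaluating
at `b` gives `Π(b) + a ^ (q + 1) Π'(b) = -1`. If `a = 0`, only the first term survives; otherwise
`b` is a root of `Π`, and `Π'(b)` is the product over `c ≠ b`. -/
theorem weight_eq (S : AffinePoint q F) : weight S = -1 := by
  classical
  have hqF : (q : F) = 0 := q_cast hq.out
  obtain ⟨⟨a, b⟩, hab⟩ := S
  change a ^ (q + 1) = b ^ q + b at hab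
  have h := congrArg (fun p => (derivative p).eval b) (mul_prod_traceNonzero (q := q) (F := F))
  simp only [derivative_mul, derivative_add, derivative_sub, derivative_X_pow, derivative_X,
    eval_add, eval_mul, eval_sub, eval_pow, eval_X, eval_C, eval_one, Nat.cast_pow, hqF,
    ← hab] at h
  have hh : ∀ s : Finset F, (∏ c ∈ s, (X - C c)).eval b = ∏ c ∈ s, (b - c) := fun s => by
    rw [eval_prod]; simp
  unfold weight
  split_ifs with h0
  · change a = 0 at h0
    rw [hh] at h
    simpa [h0] using h
  · change a ≠ 0 at h0
    have hb : b ∈ traceNonzero q F := by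
      simp [traceNonzero, ← hab, h0]
    rw [← Finset.mul_prod_erase _ _ hb, derivative_mul] at h
    simp only [eval_add, eval_mul, eval_sub, eval_X, eval_C, sub_self, derivative_sub,
      derivative_X, derivative_C, eval_one, hh] at h
    simpa using h

theorem x_ne_zero : x q F ≠ 0 := fun h => by
  simpa [h] using derivationX_x (q := q) (F := F)

variable (q F) in
-- Raise the equation to the power `q` and subtract the equation itself; the terms `y ^ q` cancel.
theorem y_pow_sub : y q F ^ q ^ 2 - y q F = x q F ^ q * (x q F ^ q ^ 2 - x q F) := by
  have h : (y q F ^ q + y q F) ^ q = y q F ^ q ^ 2 + y q F ^ q := by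
    rw [add_pow_q F, ← pow_mul, sq]
  have e := equation (q := q) (F := F)
  rw [← e] at h
  have h2 : (x q F ^ (q + 1)) ^ q = x q F ^ q * x q F ^ q ^ 2 := by ring
  rw [h2] at h
  linear_combination e - h

/-- At `y` the polynomial identity `mul_prod_traceNonzero` reads `x ^ q R = x ^ q (x ^ (q ^ 2) -
x)`. -/
theorem R_eq : R q F = x q F ^ q ^ 2 - x q F := by
  have h := congrArg (aeval (y q F)) (mul_prod_traceNonzero (q := q) (F := F))
  simp only [map_mul, map_add, map_sub, map_prod, map_pow, aeval_X, aeval_C, y_pow_sub] at h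
  refine mul_left_cancel₀ (pow_ne_zero q (x_ne_zero (q := q) (F := F))) ?_
  rw [← h, ← equation, R]
  ring

theorem prod_sub_algebraMap {K : Type*} [Field K] [Algebra F K] (z : K) :
    ∏ c : F, (z - algebraMap F K c) = z ^ q ^ 2 - z := by
  have h := congrArg (aeval z) (prod_X_sub_C_univ (q := q) (F := F))
  simpa [map_prod] using h

/-- A function is congruent to a constant modulo a place if its image in the residue field is
fixed by the Frobenius endomorphism. -/
theorem exists_sub_mem_nonunits {K : Type*} [Field K] [Algebra F K] {P : Place F K} {z : K}
    (hz : z ∈ P.ring) (h : z ^ q ^ 2 - z ∈ P.ring.nonunits) :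
    ∃ c : F, z - algebraMap F K c ∈ P.ring.nonunits := by
  by_contra! hne
  have h1 : ∀ c : F, P.ring.valuation (z - algebraMap F K c) = 1 := fun c =>
    le_antisymm (Place.mem_ring_iff.1 (sub_mem hz (P.algebraMap_mem c)))
      (not_lt.1 fun hlt => hne c (Place.mem_nonunits_iff.2 hlt))
  rw [← prod_sub_algebraMap (F := F), Place.mem_nonunits_iff, map_prod, Finset.prod_congr rfl
    fun c _ => h1 c, Finset.prod_const_one] at h
  exact h.false

/-! ### The places of the curve and the zeros of `R` -/

theorem one_notMem_nonunits {K : Type*} [Field K] (A : ValuationSubring K) :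
    (1 : K) ∉ A.nonunits := by
  simp [ValuationSubring.mem_nonunits_iff]

/-- A place of the Hermitian function field is centred on the affine curve or is `P_∞`. -/
theorem algHom_mem_or_eq_placeInf (P : Place F (FunctionField q F)) :
    (∀ g, Algebra.algHom F (CoordinateRing q F) (FunctionField q F) g ∈ P.ring) ∨
      P = placeInf := by
  have hq2 := two_le_q hq.out
  by_cases hy : y q F ∈ P.ring
  · left
    -- Valuation rings are integrally closed, and `x ^ (q + 1)` is regular with `y`.
    have hx : x q F ∈ P.ring := by
      have h : x q F ^ (q + 1) ∈ P.ring := by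
        rw [equation]
        exact add_mem (pow_mem hy q) hy
      rw [Place.mem_ring_iff, map_pow] at h
      exact Place.mem_ring_iff.2 ((pow_le_one_iff (Nat.succ_ne_zero q)).1 h)
    intro g
    have hg : g ∈ Algebra.adjoin F
        {AdjoinRoot.root (poly q F), AdjoinRoot.of (poly q F) X} :=
      adjoin_root_of_X (q := q) (F := F) ▸ Algebra.mem_top
    induction hg using Algebra.adjoin_induction with
    | mem z hz =>
      rcases hz with rfl | rfl
      · exact hx
      · exact hy
    | algebraMap c => rw [AlgHom.commutes]; exact P.algebraMap_mem c
    | add a b _ _ ha hb => rw [map_add]; exact add_mem ha hb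
    | mul a b _ _ ha hb => rw [map_mul]; exact mul_mem ha hb
  · right
    have hw : (y q F)⁻¹ ∈ P.ring.nonunits := by
      rw [ValuationSubring.inv_mem_nonunits_iff]
      exact Or.inr hy
    have hwz := chart_equation (chartInf (q := q) (F := F))
    have hcw : chartInf (AdjoinRoot.of (poly q F) X) = (y q F)⁻¹ := by simp [chartInf]
    rw [hcw] at hwz
    -- As `1 / y` vanishes at `P`, the equation of the chart at infinity forces `x / y` to vanish
    -- too, so `P` is centred at the origin of that chart.
    have hz : chartInf (AdjoinRoot.root (poly q F)) ∈ P.ring.nonunits := by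
      rw [Place.mem_nonunits_iff] at hw ⊢
      rw [← pow_lt_one_iff (Nat.succ_ne_zero q), ← map_pow, hwz]
      refine Valuation.map_add_lt _ ?_ hw
      rw [map_pow]
      exact pow_lt_one₀ zero_le hw (by omega)
    refine eq_placeOf _ _ _ _ _ ?_ ?_
    · simpa using hz
    · simpa [hcw] using hw

theorem exists_isCoordinate_x {P : Place F (FunctionField q F)}
    (hP : ∀ g, Algebra.algHom F (CoordinateRing q F) (FunctionField q F) g ∈ P.ring) :
    ∃ δ, P.IsCoordinate (x q F) δ :=
  exists_isCoordinate_of_chart _ algHom_surjective P hP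

theorem algHom_mem_place (S : AffinePoint q F) (g : CoordinateRing q F) :
    Algebra.algHom F (CoordinateRing q F) (FunctionField q F) g ∈ (place S).ring :=
  mem_placeOf _ _ _ S g

theorem exists_isCoordinate (P : Place F (FunctionField q F)) :
    ∃ z δ, P.IsCoordinate z δ := by
  rcases algHom_mem_or_eq_placeInf P with h | rfl
  · exact ⟨_, exists_isCoordinate_x h⟩
  · exact ⟨_, exists_isCoordinate_of_chart chartInf chartInf_surjective _
      (mem_placeOf _ chartInf_injective chartInf_surjective _)⟩

theorem derivation_R {M : Type*} [AddCommGroup M] [Module F M] [Module (FunctionField q F) M]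
    (d : Derivation F (FunctionField q F) M) : d (R q F) = -d (x q F) := by
  have hqK : (q : FunctionField q F) = 0 := by
    rw [← map_natCast (algebraMap F (FunctionField q F)), q_cast hq.out, map_zero]
  rw [R_eq, map_sub, Derivation.leibniz_pow, ← Nat.cast_smul_eq_nsmul (FunctionField q F)]
  push_cast
  simp [hqK]

theorem R_mem_nonunits_place (S : AffinePoint q F) : R q F ∈ (place S).ring.nonunits := by
  have h := mem_nonunits_placeOf (Algebra.algHom F (CoordinateRing q F) (FunctionField q F))
    algHom_injective algHom_surjective S (g := AdjoinRoot.root _ ^ q ^ 2 - AdjoinRoot.root _)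
    (by rw [map_sub, map_pow, evalAt_root, ← hq.out, FiniteField.pow_card, sub_self])
  rw [map_sub, map_pow] at h
  rw [R_eq]
  exact h

/-- The derivative of `R` with respect to the coordinate `x` is `-1`, so its zeros on the affine
curve are simple. -/
theorem isUniformizer_R {P : Place F (FunctionField q F)}
    (hP : ∀ g, Algebra.algHom F (CoordinateRing q F) (FunctionField q F) g ∈ P.ring)
    (h : R q F ∈ P.ring.nonunits) : P.IsUniformizer (R q F) := by
  obtain ⟨δ, hδ⟩ := exists_isCoordinate_x hP
  refine hδ.isUniformizer_of_apply_not_mem h ?_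
  rw [derivation_R, hδ.apply_self, ValuationSubring.mem_nonunits_iff, Valuation.map_neg, map_one]
  exact lt_irrefl _

/-- The zeros of `R` on the affine curve are the rational points. -/
theorem exists_eq_place {P : Place F (FunctionField q F)}
    (hP : ∀ g, Algebra.algHom F (CoordinateRing q F) (FunctionField q F) g ∈ P.ring)
    (h : R q F ∈ P.ring.nonunits) : ∃ S : AffinePoint q F, P = place S := by
  have hx : x q F ∈ P.ring := hP (AdjoinRoot.root _)
  have hy : y q F ∈ P.ring := hP (AdjoinRoot.of _ X)
  rw [R_eq] at h
  obtain ⟨a, ha⟩ := exists_sub_mem_nonunits hx h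
  -- A zero of `R` is a zero of its multiple `y ^ (q ^ 2) - y`, so `y` too has its value in `F`.
  obtain ⟨b, hb⟩ := exists_sub_mem_nonunits (q := q) hy (by
    rw [y_pow_sub, mul_comm]
    rw [Place.mem_nonunits_iff] at h ⊢
    rw [map_mul]
    exact mul_lt_one_of_lt_of_le h (Place.mem_ring_iff.1 (pow_mem hx q)))
  -- The equation of the curve is reduced to the residue field, into which `F` embeds.
  have hab : a ^ (q + 1) = b ^ q + b := by
    rw [← sub_eq_zero, ← Place.algebraMap_mem_nonunits_iff (P := P) (K := FunctionField q F),
      map_sub, Place.sub_mem_nonunits_iff (P.algebraMap_mem _) (P.algebraMap_mem _)]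
    rw [Place.sub_mem_nonunits_iff hx (P.algebraMap_mem _)] at ha
    rw [Place.sub_mem_nonunits_iff hy (P.algebraMap_mem _)] at hb
    have h1 : (⟨_, P.algebraMap_mem (a ^ (q + 1))⟩ : P.ring) = ⟨_, P.algebraMap_mem a⟩ ^ (q + 1) :=
      Subtype.ext (map_pow _ _ _)
    have h2 : (⟨_, P.algebraMap_mem (b ^ q + b)⟩ : P.ring) =
        ⟨_, P.algebraMap_mem b⟩ ^ q + ⟨_, P.algebraMap_mem b⟩ :=
      Subtype.ext (by simp)
    have h3 : (⟨_, hx⟩ : P.ring) ^ (q + 1) = ⟨_, hy⟩ ^ q + ⟨_, hy⟩ := Subtype.ext equation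
    rw [h1, h2, map_pow, map_add, map_pow, ← ha, ← hb, ← map_pow, h3, map_add, map_pow]
  exact ⟨⟨(a, b), hab⟩, eq_placeOf _ _ _ _ _ ha hb⟩

theorem place_injective : Function.Injective (place (q := q) (F := F)) := by
  intro S T h
  have key : ∀ g : CoordinateRing q F, evalAt S g = evalAt T g := by
    intro g
    have hS := mem_nonunits_placeOf (Algebra.algHom F (CoordinateRing q F) (FunctionField q F))
      algHom_injective algHom_surjective S (g := g - algebraMap F _ (evalAt S g)) (by simp)
    have hT := mem_nonunits_placeOf (Algebra.algHom F (CoordinateRing q F) (FunctionField q F))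
      algHom_injective algHom_surjective T (g := g - algebraMap F _ (evalAt T g)) (by simp)
    change _ ∈ (place S).ring.nonunits at hS
    change _ ∈ (place T).ring.nonunits at hT
    rw [← h] at hT
    rw [Place.mem_nonunits_iff, map_sub, AlgHom.commutes] at hS hT
    rw [← sub_eq_zero,
      ← Place.algebraMap_mem_nonunits_iff (P := place S) (K := FunctionField q F),
      Place.mem_nonunits_iff, map_sub]
    have := Valuation.map_sub_lt _ hT hS
    rwa [sub_sub_sub_cancel_left] at this
  refine Subtype.ext (Prod.ext ?_ ?_)
  · rw [← evalAt_root, ← evalAt_root, key]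
  · rw [← evalAt_of_X, ← evalAt_of_X, key]

theorem place_ne_placeInf (S : AffinePoint q F) : place S ≠ placeInf := by
  intro h
  have h1 : y q F ∈ (place S).ring := algHom_mem_place S (AdjoinRoot.of _ X)
  have h2 : chartInf (AdjoinRoot.of (poly q F) X) ∈ (placeInf (q := q) (F := F)).ring.nonunits :=
    mem_nonunits_placeOf chartInf chartInf_injective chartInf_surjective _ (evalAt_of_X _)
  have hcw : chartInf (AdjoinRoot.of (poly q F) X) = (y q F)⁻¹ := by simp [chartInf]
  rw [hcw, ← h, ValuationSubring.inv_mem_nonunits_iff] at h2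
  exact h2.elim y_ne_zero fun h => h h1

theorem divisorSum_place (S : AffinePoint q F) :
    AGCode.divisorSum (place (q := q) (F := F)) (place S) = 1 := by
  classical
  simp [AGCode.divisorSum, Finsupp.finsetSum_apply, Finsupp.single_apply,
    place_injective.eq_iff]

theorem divisorSum_eq_zero {P : Place F (FunctionField q F)}
    (hP : ∀ S : AffinePoint q F, P ≠ place S) :
    AGCode.divisorSum (place (q := q) (F := F)) P = 0 := by
  classical
  simp [AGCode.divisorSum, Finsupp.finsetSum_apply, 
    fun S => (hP S).symm]

end Hermitian

/-! ### The divisor and the residues of `f dx / R` -/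

namespace Hermitian

variable {q : ℕ} {F : Type*} [Field F] [Fintype F] [hq : Fact (Fintype.card F = q ^ 2)]

theorem R_ne_zero : R q F ≠ 0 := fun h => by
  have h1 := derivation_R (derivationX q F)
  rw [h, map_zero, derivationX_x] at h1
  exact one_ne_zero (neg_eq_zero.1 h1.symm)

theorem D_x_ne_zero : KaehlerDifferential.D F (FunctionField q F) (x q F) ≠ 0 := fun h => by
  have h1 := congrArg (derivationX q F).liftKaehlerDifferential h
  rw [Derivation.liftKaehlerDifferential_comp_D, derivationX_x, map_zero] at h1
  exact one_ne_zero h1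

theorem exists_eq_smul_D_x (ω : KaehlerDifferential F (FunctionField q F)) :
    ∃ h : FunctionField q F, ω = h • KaehlerDifferential.D F _ (x q F) := by
  have hq0 : q ≠ 0 := by
    have := two_le_q hq.out
    omega
  obtain ⟨δ, hδ⟩ := exists_isCoordinate_x
    (algHom_mem_place (⟨(0, 0), by simp [hq0]⟩ : AffinePoint q F))
  exact hδ.exists_eq_smul_D ω

/-- At `P_∞` the function `x / y` is a coordinate and a local parameter, and `1 / y` has order
`q + 1`. -/
theorem exists_isCoordinate_placeInf :
    ∃ δ, (placeInf (q := q) (F := F)).IsCoordinate (x q F / y q F) δ ∧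
      placeInf.ord (x q F / y q F) = 1 ∧ placeInf.ord (y q F)⁻¹ = q + 1 ∧
      (x q F / y q F) ^ (q + 1) = (y q F)⁻¹ ^ q + (y q F)⁻¹ := by
  have hq2 := two_le_q hq.out
  obtain ⟨δ, hδ⟩ := exists_isCoordinate_of_chart chartInf chartInf_surjective
    (placeInf (q := q) (F := F)) (mem_placeOf _ chartInf_injective chartInf_surjective _)
  have hcz : chartInf (AdjoinRoot.root (poly q F)) = x q F / y q F := by simp [chartInf]
  have hcw : chartInf (AdjoinRoot.of (poly q F) X) = (y q F)⁻¹ := by simp [chartInf]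
  have hzn := mem_nonunits_placeOf chartInf chartInf_injective chartInf_surjective
    (⟨(0, 0), by simp [zero_pow (show q ≠ 0 by omega)]⟩ : AffinePoint q F)
    (g := AdjoinRoot.root (poly q F)) (evalAt_root _)
  have hwn := mem_nonunits_placeOf chartInf chartInf_injective chartInf_surjective
    (⟨(0, 0), by simp [zero_pow (show q ≠ 0 by omega)]⟩ : AffinePoint q F)
    (g := AdjoinRoot.of (poly q F) X) (evalAt_of_X _)
  change _ ∈ placeInf.ring.nonunits at hzn
  change _ ∈ placeInf.ring.nonunits at hwn
  have heq := chart_equation (chartInf (q := q) (F := F))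
  rw [hcz] at hδ hzn heq
  rw [hcw] at hwn heq
  have hz : placeInf.IsUniformizer (x q F / y q F) := by
    refine hδ.isUniformizer_of_apply_not_mem hzn ?_
    rw [hδ.apply_self]
    exact one_notMem_nonunits _
  have hord := hδ.ord_eq_one hz
  refine ⟨δ, hδ, hord, ?_, heq⟩
  -- In `z ^ (q + 1) = w ^ q + w` the term `w` dominates, so `w` has the order of `z ^ (q + 1)`.
  have hlt : placeInf.ring.valuation ((y q F)⁻¹ ^ q) < placeInf.ring.valuation (y q F)⁻¹ := by
    rw [Place.mem_nonunits_iff] at hwn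
    rw [map_pow]
    exact pow_lt_self_of_lt_one₀ (zero_lt_iff.2 ((Valuation.ne_zero_iff _).2
      (inv_ne_zero y_ne_zero))) hwn (by omega)
  rw [← Place.ord_congr (f := (x q F / y q F) ^ (q + 1)), hδ.ord_pow hz.1, hord]
  · push_cast
    ring
  · rw [heq, Valuation.map_add_eq_of_lt_right _ hlt]

theorem ord_placeInf_x : placeInf.ord (x q F) = -q := by
  obtain ⟨δ, hδ, hz, hw, -⟩ := exists_isCoordinate_placeInf (q := q) (F := F)
  have h : x q F = x q F / y q F / (y q F)⁻¹ := by
    have := y_ne_zero (q := q) (F := F)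
    field_simp
  rw [h, hδ.ord_div (div_ne_zero x_ne_zero y_ne_zero) (inv_ne_zero y_ne_zero), hz, hw]
  ring

/-- At the pole `P_∞` of `x`, the term `x ^ (q ^ 2)` dominates in `R`, and `x` has order `-q`. -/
theorem ord_placeInf_R : placeInf.ord (R q F) = -(q : ℤ) ^ 3 := by
  have hq2 := two_le_q hq.out
  obtain ⟨δ, hδ, -⟩ := exists_isCoordinate_placeInf (q := q) (F := F)
  have hx : 1 < placeInf.ring.valuation (x q F) := by
    rw [← not_le, ← Place.mem_ring_iff, hδ.mem_ring_iff_ord x_ne_zero, ord_placeInf_x]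
    omega
  have hlt : placeInf.ring.valuation (x q F) < placeInf.ring.valuation (x q F ^ q ^ 2) := by
    rw [map_pow]
    exact lt_self_pow₀ hx (by nlinarith)
  rw [R_eq, Place.ord_congr (Valuation.map_sub_eq_of_lt_left _ hlt),
    hδ.ord_pow x_ne_zero, ord_placeInf_x]
  push_cast
  ring

/-- With `z = x / y` and `w = 1 / y`, one has `x = z / w` and `dw = z ^ q dz`, whence `dx = (w - z ^
(q + 1)) / w ^ 2 dz = -w ^ (q - 2) dz`, of order `(q + 1) (q - 2)`. -/
theorem ordDiff_placeInf_D_x :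
    placeInf.ordDiff (KaehlerDifferential.D F _ (x q F)) = (q : ℤ) ^ 2 - q - 2 := by
  have hq2 := two_le_q hq.out
  obtain ⟨δ, hδ, -, hw, heq⟩ := exists_isCoordinate_placeInf (q := q) (F := F)
  have hy0 := y_ne_zero (q := q) (F := F)
  have hw0 := inv_ne_zero hy0
  have hδw : δ (y q F)⁻¹ = (x q F / y q F) ^ q := by
    rw [derivation_apply_of_equation δ heq, hδ.apply_self, smul_eq_mul, mul_one]
  have hδx : δ (x q F) = -((y q F)⁻¹ ^ q / (y q F)⁻¹ ^ 2) := by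
    have h : x q F = x q F / y q F / (y q F)⁻¹ := by field_simp
    conv_lhs => rw [h, Derivation.leibniz_div, hδw, hδ.apply_self]
    have h2 : x q F / y q F * (x q F / y q F) ^ q = (y q F)⁻¹ ^ q + (y q F)⁻¹ := by
      rw [← heq]; ring
    rw [smul_eq_mul, smul_eq_mul, smul_eq_mul, h2]
    field_simp
    ring
  have hne : (y q F)⁻¹ ^ q / (y q F)⁻¹ ^ 2 ≠ 0 := div_ne_zero (pow_ne_zero _ hw0) (pow_ne_zero _ hw0)
  rw [hδ.D_eq (x q F), hδx, hδ.ordDiff_smul_D (neg_ne_zero.2 hne),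
    Place.ord_congr (Valuation.map_neg _ _), hδ.ord_div (pow_ne_zero _ hw0) (pow_ne_zero _ hw0),
    hδ.ord_pow hw0, hδ.ord_pow hw0, hw]
  push_cast
  ring

/-- The divisor of the differential `dx / R` is `(q ^ 3 + q ^ 2 - q - 2) P_∞ - D`. -/
theorem ordDiff_smul_D_x (P : Place F (FunctionField q F)) {f : FunctionField q F} (hf : f ≠ 0) :
    P.ordDiff ((f / R q F) • KaehlerDifferential.D F _ (x q F)) = P.ord f +
      Finsupp.single placeInf ((q : ℤ) ^ 3 + (q : ℤ) ^ 2 - (q : ℤ) - 2) P -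
      AGCode.divisorSum (place (q := q) (F := F)) P := by
  obtain ⟨z, δ, hδ⟩ := exists_isCoordinate P
  rw [hδ.ordDiff_smul (div_ne_zero hf R_ne_zero) D_x_ne_zero, hδ.ord_div hf R_ne_zero]
  rcases algHom_mem_or_eq_placeInf P with hP | rfl
  · obtain ⟨δ', hδ'⟩ := exists_isCoordinate_x hP
    have hdx : P.ordDiff (KaehlerDifferential.D F _ (x q F)) = 0 := by
      rw [← one_smul (FunctionField q F) (KaehlerDifferential.D F _ (x q F)),
        hδ'.ordDiff_smul_D one_ne_zero]
      exact hδ'.ord_eq_zero (map_one _)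
    have hRO : R q F ∈ P.ring := by
      rw [R_eq]
      exact sub_mem (pow_mem (hP (AdjoinRoot.root _)) _) (hP (AdjoinRoot.root _))
    have hinf : P ≠ placeInf := by
      rintro rfl
      have h := (hδ'.mem_ring_iff_ord x_ne_zero).1 (hP (AdjoinRoot.root _))
      rw [ord_placeInf_x] at h
      have := two_le_q hq.out
      omega
    rw [hdx, Finsupp.single_eq_of_ne hinf]
    by_cases hR : R q F ∈ P.ring.nonunits
    · rw [hδ'.ord_eq_one (isUniformizer_R hP hR)]
      obtain ⟨S, rfl⟩ := exists_eq_place hP hR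
      rw [divisorSum_place]
      ring
    · rw [hδ'.ord_eq_zero (f := R q F) (le_antisymm (Place.mem_ring_iff.1 hRO)
        (not_lt.1 fun h => hR (Place.mem_nonunits_iff.2 h))), 
        divisorSum_eq_zero fun S (h : P = place S) => hR (h ▸ R_mem_nonunits_place S)]
      ring
  · rw [ord_placeInf_R, ordDiff_placeInf_D_x, Finsupp.single_eq_same,
      divisorSum_eq_zero fun S h => place_ne_placeInf S h.symm]
    ring

/-- Here `f dx / R = -f dR / R` and `R` is a local parameter, so the principal part is `-f(S) R⁻¹`.
The factor `-1` is the inverse of the weight. -/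
theorem residue_place (S : AffinePoint q F) {f : FunctionField q F} (hf : f ∈ (place S).ring) :
    (place S).residue ((f / R q F) • KaehlerDifferential.D F _ (x q F)) =
      (weight S)⁻¹ * (place S).eval f := by
  obtain ⟨δ, hδ⟩ := exists_isCoordinate_x (algHom_mem_place S)
  have hR := isUniformizer_R (algHom_mem_place S) (R_mem_nonunits_place S)
  have heval : f - algebraMap F _ ((place S).eval f) ∈ (place S).ring.nonunits :=
    Classical.epsilon_spec (exists_sub_mem_nonunits_placeOf _ algHom_injective algHom_surjective S hf)
  set c := (place S).eval f
  have hR0 := R_ne_zero (q := q) (F := F)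
  have e : (f / R q F) • KaehlerDifferential.D F (FunctionField q F) (x q F) =
      (-(f / R q F)) • KaehlerDifferential.D F _ (R q F) := by
    rw [derivation_R, smul_neg, neg_smul, neg_neg]
  rw [e, hδ.residue_eq (p := C (-c) * X) hR]
  · rw [coeff_C_mul, coeff_X_one, weight_eq, inv_neg, inv_one, mul_one, neg_one_mul]
  · have : -(f / R q F) - aeval (R q F)⁻¹ (C (-c) * X) = -((f - algebraMap F _ c) / R q F) := by
      rw [map_mul, aeval_C, aeval_X, map_neg]
      ring
    rw [this]
    exact neg_mem ((hR.2 _).1 heval)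
  · rw [mul_neg, mul_div_cancel₀ _ hR0]
    exact neg_mem hf

end Hermitian

/-! ### Comparison of the two codes -/

/-- `G` is any divisor whose support contains no affine rational place. The functions
`f ∈ 𝓛((q ^ 3 + q ^ 2 - q - 2) P_∞ - G)` correspond to the differentials `g dx ∈ Ω(G - D)` with
`g = f / R`, the residue of `g dx` at an affine rational point `S` is `u(S)⁻¹ f(S)`, and so the
weights `u(S)⁻¹` carry the functional code onto the differential code. -/
theorem mainTheorem5 (q : ℕ) (F : Type*) [Field F] [Fintype F]
    [hq : Fact (Fintype.card F = q ^ 2)] (G : Divisor F (Hermitian.FunctionField q F))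
    (hG : ∀ S : Hermitian.AffinePoint q F, G (Hermitian.place S) = 0) :
    let D : Divisor F (Hermitian.FunctionField q F) :=
      AGCode.divisorSum (Hermitian.place (q := q) (F := F))
    let E : Divisor F (Hermitian.FunctionField q F) :=
      Finsupp.single Hermitian.placeInf ((q : ℤ) ^ 3 + (q : ℤ) ^ 2 - (q : ℤ) - 2) - G
    let diff : Hermitian.FunctionField q F →
        KaehlerDifferential F (Hermitian.FunctionField q F) := fun f =>
      (f / Hermitian.R q F) • KaehlerDifferential.D F _ (Hermitian.x q F)
    AGCode.MonomiallyEquivalent (AGCode.differentialCode (Hermitian.place (q := q) (F := F)) G)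
        (AGCode.functionalCode (Hermitian.place (q := q) (F := F)) E) ∧
      Set.BijOn diff (AGCode.L E) (AGCode.Omega (G - D)) ∧
      (∀ S : Hermitian.AffinePoint q F, Hermitian.weight S ≠ 0) ∧
      (∀ f ∈ AGCode.L E, ∀ S : Hermitian.AffinePoint q F,
        (Hermitian.place S).residue (diff f) =
          (Hermitian.weight S)⁻¹ * (Hermitian.place S).eval f) ∧
      AGCode.differentialCode (Hermitian.place (q := q) (F := F)) G =
        (fun c S => (Hermitian.weight S)⁻¹ * c S) ''
          AGCode.functionalCode (Hermitian.place (q := q) (F := F)) E := by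
  intro D E diff
  have hw : ∀ S : Hermitian.AffinePoint q F, Hermitian.weight S = -1 := Hermitian.weight_eq
  have hbij : Set.BijOn diff (AGCode.L E) (AGCode.Omega (G - D)) := by
    refine ⟨fun f hf => ?_, fun f _ g _ h => ?_, fun ω hω => ?_⟩
    · by_cases hf0 : f = 0
      · left
        simp [diff, hf0]
      right
      intro P
      have h1 := hf.resolve_left hf0 P
      -- Since `div(dx / R) = E + G - D`, the conditions `-E ≤ ord f` and `G - D ≤ ord (f dx / R)`
      -- coincide at every place.
      rw [Hermitian.ordDiff_smul_D_x P hf0]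
      simp only [E, D, Finsupp.sub_apply] at h1 ⊢
      omega
    · have h1 := sub_eq_zero.2 h
      simp only [diff] at h1
      rw [← sub_smul, smul_eq_zero, or_iff_left Hermitian.D_x_ne_zero, sub_eq_zero,
        div_left_inj' Hermitian.R_ne_zero] at h1
      exact h1
    · obtain ⟨h, rfl⟩ := Hermitian.exists_eq_smul_D_x ω
      have e : diff (h * Hermitian.R q F) =
          h • KaehlerDifferential.D F _ (Hermitian.x q F) := by
        simp only [diff]
        rw [mul_div_cancel_right₀ _ Hermitian.R_ne_zero]
      refine ⟨h * Hermitian.R q F, ?_, e⟩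
      by_cases h0 : h = 0
      · left
        rw [h0, zero_mul]
      right
      intro P
      have h1 := hω.resolve_left (smul_ne_zero h0 Hermitian.D_x_ne_zero) P
      rw [← e, Hermitian.ordDiff_smul_D_x P (mul_ne_zero h0 Hermitian.R_ne_zero)] at h1
      simp only [E, D, Finsupp.sub_apply] at h1 ⊢
      omega
  have hres : ∀ f ∈ AGCode.L E, ∀ S : Hermitian.AffinePoint q F,
      (Hermitian.place S).residue (diff f) =
        (Hermitian.weight S)⁻¹ * (Hermitian.place S).eval f := by
    refine fun f hf S => Hermitian.residue_place S ?_
    by_cases hf0 : f = 0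
    · rw [hf0]
      exact zero_mem _
    obtain ⟨z, δ, hδ⟩ := Hermitian.exists_isCoordinate (Hermitian.place S)
    have h1 := hf.resolve_left hf0 (Hermitian.place S)
    -- The coefficient of `E` at an affine rational place is `0`, so `f` is regular there and the
    -- pole of `f dx / R` is at most simple.
    simp only [E, Finsupp.sub_apply, hG S,
      Finsupp.single_eq_of_ne (Hermitian.place_ne_placeInf S)] at h1
    exact (hδ.mem_ring_iff_ord hf0).2 h1
  have hcode : AGCode.differentialCode (Hermitian.place (q := q) (F := F)) G =
      (fun c S => (Hermitian.weight S)⁻¹ * c S) ''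
        AGCode.functionalCode (Hermitian.place (q := q) (F := F)) E := by
    rw [AGCode.differentialCode, AGCode.functionalCode, Set.image_image]
    change _ '' AGCode.Omega (G - D) = _
    rw [← hbij.image_eq, Set.image_image]
    exact Set.image_congr fun f hf => funext fun S => hres f hf S
  -- All weights are `-1`, so negation with the identity permutation carries either code onto the
  -- other.
  refine ⟨⟨1, fun _ => -1, ?_⟩, hbij, fun S => ?_, hres, hcode⟩
  · rw [hcode, Set.image_image]
    simp [hw]
  · rw [hw S]
    exact neg_ne_zero.2 one_ne_zero
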